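/- Let $I=[x_\ell,x_r]$ and $J=[y_b,y_t]$ be closed intervals in $\mathbb{R}$ with $x_\ell<x_r$ and $y_b<y_t$, let $n\ge 1$, and let $Q$ be a metric space with an isometry $e$ from $Q$ onto the rectangle $\{z\in\mathbb{C} : \operatorname{Re} z\in I,\ \operatorname{Im} z\in J\}$, by which we identify $Q$ with this rectangle. Let $\mathrm{Mult}_n(Q)=Q^n/\mathrm{Sym}_n$ be the space of $n$-element multisets in $Q$, with the quotient metric $d([z],[w])=\min_{\sigma\in \mathrm{Sym}_n}\bigl(\sum_i d(z_i,w_{\sigma(i)})^2\bigr)^{1/2}$. A rectangular composition of $n$ is an $(h+2)\times(k+2)$ matrix of nonnegative integers ($h,k\ge 0$) with entry sum $n$ in which no internal (neither first nor last) row and no internal column is zero. $\mathrm{Comp}_n(\square)$ is the set of all rectangular compositions of $n$, ordered by $a\le b$ if and only if $a$ is obtained from $b$ by a finite (possibly empty) sequence of row-merges (replacing two adjacent rows by their sum) and column-merges (replacing two adjacent columns by their sum), all the matrices in the sequence being rectangular compositions. For $z\in\mathrm{Mult}_n(Q)$, let $x_\ell=x_0<x_1<\cdots<x_h<x_{h+1}=x_r$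 be the points of $I$ that are endpoints of $I$ or real parts of points of $z$, and let $y_b=y_0<y_1<\cdots<y_k<y_{k+1}=y_t$ be the points of $J$ that are endpoints of $J$ or imaginary parts of points of $z$; then $\mathrm{Comp}(z)\in\mathrm{Comp}_n(\square)$ is the matrix whose $(i,j)$ entry is the multiplicity of $x_i+\mathrm{i}\,y_j$ in $z$. A $d$-dimensional orthoscheme is the convex hull of points $p_0,\ p_0+v_1,\ \dots,\ p_0+v_1+\cdots+v_d$ in a Euclidean space, where $v_1,\dots,v_d$ are nonzero and pairwise orthogonal ($d\ge0$); a bi-orthoscheme is a metric space isometric to the $\ell^2$-product of two orthoschemes. A piecewise Euclidean cell complex is a quotient of a disjoint union of convex Euclidean polytopes such that the quotient map is injective on the relative interior of every face of each polytope and, whenever it identifies a point in the relative interior of a face $F$ with a point in the relative interior of a face $G$, there is an isometry $g\colon F\to G$ such that it identifies $y$ with $g(y)$ for all $y\in F$. The complex carries the intrinsic (pseudo)metric: the infimum of the total lengths of finite strings of points in which consecutive points lie in a common polytope. Its cells are the images of the nonempty faces of the polytopes, and its face poset is the set of its cells ordered by inclusion. Then there are a piecewise Euclidean cell complex $K$,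 an isometry $f$ from $K$ onto $\mathrm{Mult}_n(Q)$, and an isomorphism of posets $\varphi$ from the face poset of $K$ onto $\mathrm{Comp}_n(\square)$ such that every face $F$ of every polytope of $K$ is a bi-orthoscheme and, if $S$ is the cell that is the image of $F$, then $f$ maps the open cell of $S$ (the image of the relative interior of $F$) onto $\{z\in\mathrm{Mult}_n(Q) : \mathrm{Comp}(z)=\varphi(S)\}$. -/

import Mathlib

open scoped ENNReal

noncomputable section

/-! ### Multiset spaces -/

/-- Two `n`-tuples are equivalent if they differ by a permutation of the coordinates. -/
def permSetoid (n : ℕ) (X : Type*) : Setoid (Fin n → X) where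
  r z w := ∃ σ : Equiv.Perm (Fin n), z = w ∘ σ
  iseqv :=
    { refl := fun _ => ⟨1, rfl⟩
      symm := by
        rintro z w ⟨σ, rfl⟩
        exact ⟨σ⁻¹, by ext i; simp⟩
      trans := by
        rintro z w u ⟨σ, rfl⟩ ⟨τ, rfl⟩
        exact ⟨τ * σ, by ext i; simp⟩ }

/-- The multiset space `Xⁿ / Sym_n`. -/
def Mult (n : ℕ) (X : Type*) : Type _ := Quotient (permSetoid n X)

namespace Mult

variable {n : ℕ} {X Y : Type*}

/-- The multiset of the entries of a tuple. -/
def mk (z : Fin n → X) : Mult n X := Quotient.mk (permSetoid n X) z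

/-- The map of multiset spaces induced by a map of spaces. -/
def map (f : X → Y) : Mult n X → Mult n Y :=
  Quotient.lift (s := permSetoid n X) (fun z => mk (f ∘ z)) (by
    rintro z w ⟨σ, rfl⟩
    exact Quotient.sound (s := permSetoid n Y) ⟨σ, rfl⟩)

/-- The multiplicity of a point in a multiset. -/
def count (z : Mult n X) (x : X) : ℕ :=
  Quotient.lift (s := permSetoid n X) (fun w => Nat.card {i : Fin n // w i = x}) (by
    rintro z w ⟨σ, rfl⟩
    exact Nat.card_congr (σ.subtypeEquiv (fun i => Iff.rfl))) z

section Metric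

variable [MetricSpace X]

/-- The `ℓ²` distance on `Xⁿ`. -/
def tupleDist (z w : Fin n → X) : ℝ := dist (WithLp.toLp 2 z) (WithLp.toLp 2 w)

theorem tupleDist_comp (z w : Fin n → X) (σ : Equiv.Perm (Fin n)) :
    tupleDist (z ∘ σ) (w ∘ σ) = tupleDist z w := by
  have h2 : 0 < (2 : ℝ≥0∞).toReal := by norm_num
  simp only [tupleDist, PiLp.dist_eq_sum h2, Function.comp]
  rw [Equiv.sum_comp σ (fun i => dist (z i) (w i) ^ (2 : ℝ≥0∞).toReal)]

/-- The distance between the orbits of two tuples. -/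
def orbitDist (z w : Fin n → X) : ℝ := ⨅ σ : Equiv.Perm (Fin n), tupleDist z (w ∘ σ)

theorem orbitDist_le (z w : Fin n → X) (σ : Equiv.Perm (Fin n)) :
    orbitDist z w ≤ tupleDist z (w ∘ σ) :=
  ciInf_le (Set.finite_range _).bddBelow σ

theorem exists_orbitDist_eq (z w : Fin n → X) :
    ∃ σ : Equiv.Perm (Fin n), tupleDist z (w ∘ σ) = orbitDist z w :=
  exists_eq_ciInf_of_finite

theorem orbitDist_comp_right (z w : Fin n → X) (τ : Equiv.Perm (Fin n)) :
    orbitDist z (w ∘ τ) = orbitDist z w := by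
  unfold orbitDist
  exact (Equiv.mulLeft τ).iInf_congr (fun σ => rfl)

theorem orbitDist_comm (z w : Fin n → X) : orbitDist z w = orbitDist w z := by
  have key : ∀ z w : Fin n → X, orbitDist z w ≤ orbitDist w z := by
    intro z w
    obtain ⟨σ, hσ⟩ := exists_orbitDist_eq w z
    refine (orbitDist_le z w σ⁻¹).trans (le_of_eq ?_)
    rw [← hσ, ← tupleDist_comp z (w ∘ ⇑σ⁻¹) σ]
    have : (w ∘ ⇑σ⁻¹) ∘ ⇑σ = w := by ext i; simp
    rw [this]
    exact dist_comm _ _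
  exact le_antisymm (key z w) (key w z)

/-- The quotient metric on `Xⁿ / Sym_n`, where `Xⁿ` carries the `ℓ²` product metric:
the distance of two multisets is the distance of the corresponding orbits. -/
instance : MetricSpace (Mult n X) where
  dist := Quotient.lift₂ (s₁ := permSetoid n X) (s₂ := permSetoid n X) orbitDist (by
    rintro z w z' w' ⟨σ, rfl⟩ ⟨τ, rfl⟩
    rw [orbitDist_comp_right, orbitDist_comm, orbitDist_comp_right, orbitDist_comm])
  dist_self := by
    rintro ⟨z⟩
    refine le_antisymm ((orbitDist_le z z 1).trans (le_of_eq ?_)) ?_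
    · exact dist_self _
    · exact Real.iInf_nonneg (fun σ => dist_nonneg)
  dist_comm := by
    rintro ⟨z⟩ ⟨w⟩
    exact orbitDist_comm z w
  dist_triangle := by
    rintro ⟨z⟩ ⟨w⟩ ⟨u⟩
    change orbitDist z u ≤ orbitDist z w + orbitDist w u
    obtain ⟨σ, hσ⟩ := exists_orbitDist_eq z w
    obtain ⟨τ, hτ⟩ := exists_orbitDist_eq w u
    rw [← hσ, ← hτ, ← tupleDist_comp w (u ∘ τ) σ]
    exact (orbitDist_le z u (τ * σ)).trans (dist_triangle _ _ _)
  eq_of_dist_eq_zero := by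
    rintro ⟨z⟩ ⟨w⟩ h
    change orbitDist z w = 0 at h
    obtain ⟨σ, hσ⟩ := exists_orbitDist_eq z w
    rw [h] at hσ
    have h' := (WithLp.toLp_injective 2) (eq_of_dist_eq_zero hσ)
    exact Quotient.sound (s := permSetoid n X) ⟨σ, h'⟩

end Metric

end Mult

/-! ### Rectangular compositions -/

/-- A matrix of nonnegative integers with at least two rows and two columns, with entry sum `n`,
and with no internal row or column that sums to zero. -/
structure IsRectComposition (n : ℕ) {h k : ℕ} (M : Matrix (Fin (h + 2)) (Fin (k + 2)) ℕ) :
    Prop where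
  row_pos : ∀ i, i ≠ 0 → i ≠ Fin.last (h + 1) → 0 < ∑ j, M i j
  col_pos : ∀ j, j ≠ 0 → j ≠ Fin.last (k + 1) → 0 < ∑ i, M i j
  sum_eq : ∑ i, ∑ j, M i j = n

/-- Rectangular compositions of `n`, of all shapes `(h + 2) × (k + 2)`. -/
structure RectComp (n : ℕ) where
  h : ℕ
  k : ℕ
  mat : Matrix (Fin (h + 2)) (Fin (k + 2)) ℕ
  isComp : IsRectComposition n mat

/-- Replace the adjacent rows `p` and `p + 1` by their sum. The map `p.predAbove` is the monotone
surjection that identifies `p` with `p + 1` and is injective otherwise. -/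
def rowMerge {h k : ℕ} (p : Fin (h + 2)) (M : Matrix (Fin (h + 3)) (Fin (k + 2)) ℕ) :
    Matrix (Fin (h + 2)) (Fin (k + 2)) ℕ :=
  fun i j => ∑ i' with p.predAbove i' = i, M i' j

/-- Replace the adjacent columns `p` and `p + 1` by their sum. -/
def colMerge {h k : ℕ} (p : Fin (k + 2)) (M : Matrix (Fin (h + 2)) (Fin (k + 3)) ℕ) :
    Matrix (Fin (h + 2)) (Fin (k + 2)) ℕ :=
  fun i j => ∑ j' with p.predAbove j' = j, M i j'

namespace RectComp

variable {n : ℕ}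

/-- `Merge b a`: the composition `a` arises from `b` by one row-merge or one column-merge.
(The merged matrix is always a composition again.) -/
inductive Merge : RectComp n → RectComp n → Prop
  | row {h k : ℕ} (p : Fin (h + 2)) (M : Matrix (Fin (h + 3)) (Fin (k + 2)) ℕ)
      (hM : IsRectComposition n M) (hN : IsRectComposition n (rowMerge p M)) :
      Merge ⟨h + 1, k, M, hM⟩ ⟨h, k, rowMerge p M, hN⟩
  | col {h k : ℕ} (p : Fin (k + 2)) (M : Matrix (Fin (h + 2)) (Fin (k + 3)) ℕ)
      (hM : IsRectComposition n M) (hN : IsRectComposition n (colMerge p M)) :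
      Merge ⟨h, k + 1, M, hM⟩ ⟨h, k, colMerge p M, hN⟩

theorem eq_or_lt_of_merges {a b : RectComp n} (hab : Relation.ReflTransGen Merge b a) :
    a = b ∨ a.h + a.k < b.h + b.k := by
  induction hab with
  | refl => exact Or.inl rfl
  | tail _ hm ih =>
    right
    cases hm <;> rcases ih with rfl | ih <;> simp only at * <;> omega

/-- `a ≤ b` if `a` arises from `b` by a finite sequence of row-merges and column-merges. -/
instance : PartialOrder (RectComp n) where
  le a b := Relation.ReflTransGen Merge b a
  le_refl _ := Relation.ReflTransGen.refl
  le_trans _ _ _ hab hbc := Relation.ReflTransGen.trans hbc hab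
  le_antisymm a b hab hba := by
    rcases eq_or_lt_of_merges hab with h | h
    · exact h
    · rcases eq_or_lt_of_merges hba with h' | h'
      · exact h'.symm
      · omega

end RectComp

/-! ### Piecewise Euclidean cell complexes -/

/-- A piecewise Euclidean cell complex: a quotient of a disjoint union of convex polytopes in
Euclidean spaces that is injective on the relative interior of every face, and such that, whenever
two points in the relative interiors of two faces are identified, these whole faces are identified
through an isometry. Faces are the nonempty exposed faces. -/
structure EuclideanComplex where
  ι : Type
  dim : ι → ℕ
  cell : ∀ i, Set (EuclideanSpace ℝ (Fin (dim i)))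
  polytope : ∀ i, ∃ s : Finset (EuclideanSpace ℝ (Fin (dim i))),
    s.Nonempty ∧ cell i = convexHull ℝ (s : Set (EuclideanSpace ℝ (Fin (dim i))))
  rel : Setoid (Σ i, cell i)
  inj : ∀ (i : ι) (F : Set (EuclideanSpace ℝ (Fin (dim i)))), IsExposed ℝ (cell i) F →
    ∀ u v : cell i, (u : EuclideanSpace ℝ (Fin (dim i))) ∈ intrinsicInterior ℝ F →
      (v : EuclideanSpace ℝ (Fin (dim i))) ∈ intrinsicInterior ℝ F →
      rel ⟨i, u⟩ ⟨i, v⟩ → u = v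
  glue : ∀ (i j : ι) (F : Set (EuclideanSpace ℝ (Fin (dim i))))
    (G : Set (EuclideanSpace ℝ (Fin (dim j))))
    (hF : IsExposed ℝ (cell i) F) (hG : IsExposed ℝ (cell j) G) (u : cell i) (v : cell j),
    (u : EuclideanSpace ℝ (Fin (dim i))) ∈ intrinsicInterior ℝ F →
    (v : EuclideanSpace ℝ (Fin (dim j))) ∈ intrinsicInterior ℝ G →
    rel ⟨i, u⟩ ⟨j, v⟩ →
    ∃ g : F ≃ᵢ G, ∀ y : F, rel ⟨i, ⟨y, hF.subset y.2⟩⟩ ⟨j, ⟨g y, hG.subset (g y).2⟩⟩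

namespace EuclideanComplex

variable (K : EuclideanComplex)

/-- The underlying set of the complex. -/
def Space : Type := Quotient K.rel

/-- The point of the complex given by a point of one of the polytopes. -/
def pt (i : K.ι) (u : K.cell i) : K.Space := Quotient.mk K.rel ⟨i, u⟩

/-- `K.StringLength x y L`: there is a finite string of points from `x` to `y`, consecutive points
lying in a common polytope, with total length `L`. -/
inductive StringLength : K.Space → K.Space → ℝ≥0∞ → Prop
  | refl (x : K.Space) : StringLength x x 0
  | step (i : K.ι) (u v : K.cell i) {y : K.Space} {L : ℝ≥0∞} :
      StringLength (K.pt i v) y L → StringLength (K.pt i u) y (edist u v + L)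

variable {K}

theorem StringLength.trans {x y z : K.Space} {L M : ℝ≥0∞} (h : K.StringLength x y L)
    (h' : K.StringLength y z M) : K.StringLength x z (L + M) := by
  induction h with
  | refl => simpa using h'
  | step i u v _ ih =>
    rw [add_assoc]
    exact StringLength.step i u v (ih h')

theorem StringLength.symm {x y : K.Space} {L : ℝ≥0∞} (h : K.StringLength x y L) :
    K.StringLength y x L := by
  induction h with
  | refl x => exact StringLength.refl x
  | step i u v _ ih =>
    have h1 := StringLength.step i v u (StringLength.refl (K.pt i u))
    rw [add_comm]
    simpa [edist_comm] using ih.trans h1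

/-- The intrinsic distance of a piecewise Euclidean complex: the infimum of the lengths of
strings (infinite if there are none). -/
instance : PseudoEMetricSpace K.Space where
  edist x y := ⨅ (L : ℝ≥0∞) (_ : K.StringLength x y L), L
  edist_self x := le_antisymm (iInf₂_le 0 (StringLength.refl x)) bot_le
  edist_comm x y := le_antisymm
    (le_iInf₂ fun L hL => iInf₂_le L hL.symm) (le_iInf₂ fun L hL => iInf₂_le L hL.symm)
  edist_triangle x y z := by
    simp only [ENNReal.iInf_add, ENNReal.add_iInf]
    refine le_iInf₂ fun L hL => le_iInf₂ fun M hM => ?_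
    exact iInf₂_le _ (StringLength.trans hM hL)

variable (K)

/-- `F` is a nonempty face of the polytope with index `i`. -/
def IsFace (i : K.ι) (F : Set (EuclideanSpace ℝ (Fin (K.dim i)))) : Prop :=
  IsExposed ℝ (K.cell i) F ∧ F.Nonempty

/-- The image in the complex of a subset of a polytope. -/
def image (i : K.ι) (F : Set (EuclideanSpace ℝ (Fin (K.dim i)))) : Set K.Space :=
  K.pt i '' {u | (u : EuclideanSpace ℝ (Fin (K.dim i))) ∈ F}

/-- The (closed) cells of the complex: the images of the nonempty faces of the polytopes. -/
def IsCell (S : Set K.Space) : Prop := ∃ i F, K.IsFace i F ∧ S = K.image i F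

/-- The face poset: all nonempty cells, ordered by inclusion. -/
abbrev FacePoset : Type := {S : Set K.Space // K.IsCell S}

variable {K}

/-- The cell of the complex given by a face of a polytope. -/
def IsFace.toCell {i : K.ι} {F : Set (EuclideanSpace ℝ (Fin (K.dim i)))} (hF : K.IsFace i F) :
    K.FacePoset :=
  ⟨K.image i F, i, F, hF, rfl⟩

end EuclideanComplex

/-! ### Orthoschemes -/

/-- A `d`-dimensional orthoscheme: the convex hull of the points
`p₀, p₀ + v₁, …, p₀ + v₁ + ⋯ + v_d`, with nonzero pairwise orthogonal vectors `v₁, …, v_d`. -/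
def IsOrthoscheme {E : Type*} [NormedAddCommGroup E] [InnerProductSpace ℝ E] (d : ℕ)
    (S : Set E) : Prop :=
  ∃ (p : E) (v : Fin d → E), (∀ i, v i ≠ 0) ∧ (∀ i j, i ≠ j → inner ℝ (v i) (v j) = 0) ∧
    S = convexHull ℝ (Set.range fun m : Fin (d + 1) => p + ∑ i with i.castSucc < m, v i)

/-- A metric space is a bi-orthoscheme if it is isometric to the (Euclidean, `ℓ²`) product of two
orthoschemes. -/
def IsBiOrthoscheme (S : Type*) [PseudoEMetricSpace S] : Prop :=
  ∃ (d e : ℕ) (A : Set (EuclideanSpace ℝ (Fin d))) (B : Set (EuclideanSpace ℝ (Fin e))),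
    IsOrthoscheme d A ∧ IsOrthoscheme e B ∧
    Nonempty (S ≃ᵢ {w : WithLp 2 (EuclideanSpace ℝ (Fin d) × EuclideanSpace ℝ (Fin e)) |
      w.fst ∈ A ∧ w.snd ∈ B})

/-! ### Multiplicity matrices -/

/-- The rectangular composition `a` is the multiplicity matrix of the multiset `z` in the coordinate
rectangle `[xl, xr] + i [yb, yt]`: for some `xl = x 0 < x 1 < ⋯ < x (h + 1) = xr` and
`yb = y 0 < y 1 < ⋯ < y (k + 1) = yt`, the entry `a i j` is the multiplicity of the point
`(x i, y j)` in `z`. As the entries of `a` sum to `n`, all the points of `z` are counted, and as no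
internal row or column of `a` is zero, each internal `x i` is the real part and each internal `y j`
the imaginary part of a point of `z`. -/
def IsMultiplicityMatrix {n : ℕ} (xl xr yb yt : ℝ)
    (z : Mult n (Set.Icc xl xr ×ℂ Set.Icc yb yt : Set ℂ)) (a : RectComp n) : Prop :=
  ∃ (x : Fin (a.h + 2) → ℝ) (y : Fin (a.k + 2) → ℝ),
    StrictMono x ∧ x 0 = xl ∧ x (Fin.last _) = xr ∧
    StrictMono y ∧ y 0 = yb ∧ y (Fin.last _) = yt ∧
    ∀ i j, (z.map Subtype.val).count (⟨x i, y j⟩ : ℂ) = a.mat i j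

end

/-
A multiset in the rectangle is the same as a nondecreasing tuple of real parts, a nondecreasing
tuple of imaginary parts and a permutation that matches them, so `Mult_n` is glued from `n!` copies
of one polytope, the product of two simplices of sorted tuples. A face of such a simplex prescribes
which of the numbers `a ≤ x_1 ≤ ⋯ ≤ x_n ≤ b` coincide: passing to a face merges rows or columns of
the multiplicity matrix, and relative interiors are the level sets of that matrix. For the metric,
the segment between two optimally matched tuples is cut by the hyperplanes `re z_i = re z_j` and
`im z_i = im z_j` into pieces on each of which the order of the coordinates is constant; every piece
lies in one polytope, so the intrinsic distance is at most the distance in `Mult_n`. The converse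
inequality holds because each polytope maps to `Mult_n` without increasing distances.
-/

section Polyhedron

variable {E κ : Type*} [NormedAddCommGroup E] [NormedSpace ℝ E]

theorem exists_lineMap_mem_of_mem_intrinsicInterior {F : Set E} {u y : E}
    (hu : u ∈ intrinsicInterior ℝ F) (hy : y ∈ F) :
    ∃ t : ℝ, 1 < t ∧ AffineMap.lineMap y u t ∈ F := by
  obtain ⟨u, hu, rfl⟩ := mem_intrinsicInterior.1 hu
  let γ : ℝ → affineSpan ℝ F := fun t =>
    ⟨AffineMap.lineMap y (u : E) t, AffineMap.lineMap_mem t (subset_affineSpan ℝ F hy) u.2⟩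
  have hγ : Continuous γ := AffineMap.lineMap_continuous.subtype_mk _
  have hγ₁ : γ 1 = u := Subtype.ext (AffineMap.lineMap_apply_one _ _)
  have hmem : γ ⁻¹' ((↑) ⁻¹' F) ∈ nhds (1 : ℝ) :=
    hγ.continuousAt.preimage_mem_nhds (by rwa [hγ₁, ← mem_interior_iff_mem_nhds])
  obtain ⟨t, htF, ht⟩ := Filter.nonempty_of_mem <|
    Filter.inter_mem (mem_nhdsWithin_of_mem_nhds hmem) (self_mem_nhdsWithin (s := Set.Ioi 1))
  exact ⟨t, ht, htF⟩

/-- The polyhedron cut out by the inequalities `0 ≤ f k x`. -/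
def polyhedron (f : κ → E →ᴬ[ℝ] ℝ) : Set E := {x | ∀ k, 0 ≤ f k x}

/-- The face of a polyhedron on which all the inequalities tight at `u` are tight. For `u` in the
polyhedron this is the smallest face containing `u`. -/
def tightFace (f : κ → E →ᴬ[ℝ] ℝ) (u : E) : Set E :=
  {y ∈ polyhedron f | ∀ k, f k u = 0 → f k y = 0}

variable {f : κ → E →ᴬ[ℝ] ℝ} {F : Set E} {u v y : E}

theorem convex_polyhedron (f : κ → E →ᴬ[ℝ] ℝ) : Convex ℝ (polyhedron f) := by
  have : polyhedron f = ⋂ k, (f k : E →ᵃ[ℝ] ℝ) ⁻¹' Set.Ici 0 := by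
    ext
    simp [polyhedron]
  rw [this]
  exact convex_iInter fun k => (convex_Ici 0).affine_preimage _

theorem mem_tightFace_self (hu : u ∈ polyhedron f) : u ∈ tightFace f u :=
  ⟨hu, fun _ => id⟩

theorem polyhedron_sumElim {κ' : Type*} (f : κ → E →ᴬ[ℝ] ℝ) (g : κ' → E →ᴬ[ℝ] ℝ) :
    polyhedron (Sum.elim f g) = polyhedron f ∩ polyhedron g :=
  Set.ext fun _ => Sum.forall

theorem tightFace_sumElim {κ' : Type*} (f : κ → E →ᴬ[ℝ] ℝ) (g : κ' → E →ᴬ[ℝ] ℝ) (u : E) :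
    tightFace (Sum.elim f g) u = tightFace f u ∩ tightFace g u := by
  ext
  simp only [tightFace, polyhedron_sumElim, Set.mem_ofPred_eq, Set.mem_inter_iff, Sum.forall,
    Sum.elim_inl, Sum.elim_inr]
  tauto

theorem isExposed_tightFace [Finite κ] (hu : u ∈ polyhedron f) :
    IsExposed ℝ (polyhedron f) (tightFace f u) := by
  classical
  have := Fintype.ofFinite κ
  intro _
  let s : Finset κ := {k | f k u = 0}
  refine ⟨-∑ k ∈ s, (f k).contLinear, ?_⟩
  have le_iff (y w : E) : (-∑ k ∈ s, (f k).contLinear) w ≤ (-∑ k ∈ s, (f k).contLinear) y ↔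
      ∑ k ∈ s, f k y ≤ ∑ k ∈ s, f k w := by
    have hsub (k : κ) : (f k).contLinear (y - w) = f k y - f k w :=
      (f k).contLinear_map_vsub y w
    rw [← sub_nonneg, ← map_sub, ← sub_nonpos (b := ∑ k ∈ s, f k w), ← Finset.sum_sub_distrib]
    simp [-map_sub, -ContinuousAffineMap.coe_contLinear, hsub]
  ext y
  simp only [tightFace, Set.mem_ofPred_eq, le_iff]
  refine and_congr_right fun hy =>
    ⟨fun h w hw => Finset.sum_le_sum fun k hk => ?_, fun h k hk => ?_⟩
  · rw [h k (Finset.mem_filter.1 hk).2]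
    exact hw k
  · have hsum : ∑ k ∈ s, f k y = 0 := le_antisymm
      ((h u hu).trans_eq (Finset.sum_eq_zero fun k hk => (Finset.mem_filter.1 hk).2))
      (Finset.sum_nonneg fun k _ => hy k)
    exact (Finset.sum_eq_zero_iff_of_nonneg fun k _ => hy k).1 hsum k (by simpa [s] using hk)

theorem subset_tightFace_of_mem_intrinsicInterior (hF : F ⊆ polyhedron f)
    (hu : u ∈ intrinsicInterior ℝ F) : F ⊆ tightFace f u := by
  refine fun y hy => ⟨hF hy, fun k hk => ?_⟩
  obtain ⟨t, ht, htF⟩ := exists_lineMap_mem_of_mem_intrinsicInterior hu hy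
  have hyk : 0 ≤ f k y := hF hy k
  have htk : 0 ≤ (1 - t) * f k y := by
    simpa [ContinuousAffineMap.apply_lineMap, AffineMap.lineMap_apply_ring', hk, sub_mul,
      neg_add_eq_sub] using hF htF k
  nlinarith

theorem exists_lineMap_mem_polyhedron [Finite κ] (hu : u ∈ polyhedron f) (hy : y ∈ tightFace f u) :
    ∃ t : ℝ, 1 < t ∧ AffineMap.lineMap y u t ∈ polyhedron f := by
  have key (k : κ) : ∀ᶠ t in nhdsWithin (1 : ℝ) (Set.Ioi 1), 0 ≤ f k (AffineMap.lineMap y u t) := by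
    rcases (hu k).eq_or_lt with hk | hk
    · refine Filter.Eventually.of_forall fun t => ?_
      simp [ContinuousAffineMap.apply_lineMap, ← hk, hy.2 k hk.symm]
    · have hc : Continuous fun t : ℝ => f k (AffineMap.lineMap y u t) :=
        (f k).continuous.comp AffineMap.lineMap_continuous
      refine Filter.Eventually.filter_mono nhdsWithin_le_nhds ?_
      exact (hc.continuousAt.eventually (lt_mem_nhds (by simpa using hk))).mono fun _ => le_of_lt
  obtain ⟨t, htP, ht⟩ := ((Filter.eventually_all.2 key).and self_mem_nhdsWithin).exists
  exact ⟨t, ht, htP⟩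

theorem eq_tightFace_of_mem_intrinsicInterior [Finite κ] (hF : IsExposed ℝ (polyhedron f) F)
    (hu : u ∈ intrinsicInterior ℝ F) : F = tightFace f u := by
  refine (subset_tightFace_of_mem_intrinsicInterior hF.subset hu).antisymm fun y hy => ?_
  have huF := intrinsicInterior_subset hu
  obtain ⟨t, ht, htP⟩ := exists_lineMap_mem_polyhedron (hF.subset huF) hy
  refine hF.isExtreme.left_mem_of_mem_openSegment hy.1 htP huF ?_
  rw [openSegment_eq_image_lineMap]
  refine ⟨t⁻¹, ⟨by positivity, inv_lt_one_of_one_lt₀ ht⟩, ?_⟩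
  rw [AffineMap.lineMap_lineMap_right, inv_mul_cancel₀ (by positivity), AffineMap.lineMap_apply_one]

theorem mem_intrinsicInterior_tightFace [Finite κ] (hvu : v ∈ tightFace f u)
    (huv : u ∈ tightFace f v) : v ∈ intrinsicInterior ℝ (tightFace f u) := by
  have hspan : ∀ y ∈ affineSpan ℝ (tightFace f u), ∀ k, f k u = 0 → f k y = 0 := by
    intro y hy k hk
    have hle : affineSpan ℝ (tightFace f u) ≤
        (AffineSubspace.mk' (0 : ℝ) ⊥).comap (f k : E →ᵃ[ℝ] ℝ) :=
      affineSpan_le.2 fun w hw => by simp [hw.2 k hk]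
    simpa using hle hy
  refine mem_intrinsicInterior.2 ⟨⟨v, subset_affineSpan ℝ _ hvu⟩, ?_, rfl⟩
  rw [mem_interior_iff_mem_nhds]
  have key (k : κ) : ∀ᶠ y : affineSpan ℝ (tightFace f u) in
      nhds ⟨v, subset_affineSpan ℝ _ hvu⟩, 0 ≤ f k y := by
    rcases (hvu.1 k).eq_or_lt with hk | hk
    · exact Filter.Eventually.of_forall fun y => (hspan y y.2 k (huv.2 k hk.symm)).ge
    · have hc : Continuous fun y : affineSpan ℝ (tightFace f u) => f k y :=
        (f k).continuous.comp continuous_subtype_val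
      exact (hc.continuousAt.eventually (lt_mem_nhds hk)).mono fun _ => le_of_lt
  filter_upwards [Filter.eventually_all.2 key] with y hy
  exact ⟨hy, hspan y y.2⟩

theorem mem_intrinsicInterior_tightFace_iff [Finite κ] (hu : u ∈ polyhedron f) :
    v ∈ intrinsicInterior ℝ (tightFace f u) ↔ v ∈ tightFace f u ∧ u ∈ tightFace f v := by
  refine ⟨fun hv => ⟨intrinsicInterior_subset hv, ?_⟩,
    fun h => mem_intrinsicInterior_tightFace h.1 h.2⟩
  rw [← eq_tightFace_of_mem_intrinsicInterior (isExposed_tightFace hu) hv]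
  exact mem_tightFace_self hu

theorem isExposed_and_nonempty_iff_exists_eq_tightFace [Finite κ] [FiniteDimensional ℝ E] :
    IsExposed ℝ (polyhedron f) F ∧ F.Nonempty ↔ ∃ u ∈ polyhedron f, F = tightFace f u := by
  constructor
  · rintro ⟨hF, hne⟩
    obtain ⟨u, hu⟩ := hne.intrinsicInterior (hF.convex (convex_polyhedron f))
    exact ⟨u, hF.subset (intrinsicInterior_subset hu), eq_tightFace_of_mem_intrinsicInterior hF hu⟩
  · rintro ⟨u, hu, rfl⟩
    exact ⟨isExposed_tightFace hu, u, mem_tightFace_self hu⟩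

end Polyhedron

section Chambers

variable {E κ : Type*} [NormedAddCommGroup E] [NormedSpace ℝ E]

/-- The hyperplanes `ℓ k = 0` of an arrangement that separate `P` strictly from `Q`. Two points lie
in a common closed chamber of the arrangement if and only if there are none. -/
def separating (ℓ : κ → E →ᵃ[ℝ] ℝ) (P Q : E) : Set κ := {k | ℓ k P * ℓ k Q < 0}

theorem mem_separating {ℓ : κ → E →ᵃ[ℝ] ℝ} {P Q : E} {k : κ} :
    k ∈ separating ℓ P Q ↔ ℓ k P * ℓ k Q < 0 := Iff.rfl

theorem separating_comm (ℓ : κ → E →ᵃ[ℝ] ℝ) (P Q : E) : separating ℓ P Q = separating ℓ Q P := by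
  simp only [separating, mul_comm]

theorem separating_lineMap_subset (ℓ : κ → E →ᵃ[ℝ] ℝ) (P Q : E) {t : ℝ} (ht : t ∈ Set.Icc 0 1) :
    separating ℓ P (AffineMap.lineMap P Q t) ⊆ separating ℓ P Q := by
  intro k hk
  by_contra h
  rw [mem_separating, not_lt] at h
  rw [mem_separating, AffineMap.apply_lineMap, AffineMap.lineMap_apply_ring] at hk
  nlinarith [mul_nonneg (sub_nonneg.2 ht.2) (mul_self_nonneg (ℓ k P)), mul_nonneg ht.1 h]

theorem exists_apply_lineMap_eq_zero {ℓ : E →ᵃ[ℝ] ℝ} {P Q : E} (h : ℓ P * ℓ Q < 0) :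
    ∃ t ∈ Set.Icc (0 : ℝ) 1, ℓ (AffineMap.lineMap P Q t) = 0 := by
  have h0 : (0 : ℝ) ∈ segment ℝ (ℓ P) (ℓ Q) := by
    rw [segment_eq_uIcc, Set.mem_uIcc]
    rcases mul_neg_iff.1 h with h | h
    · exact Or.inr ⟨h.2.le, h.1.le⟩
    · exact Or.inl ⟨h.1.le, h.2.le⟩
  rw [segment_eq_image_lineMap] at h0
  obtain ⟨t, ht, h0⟩ := h0
  exact ⟨t, ht, by rw [AffineMap.apply_lineMap, h0]⟩

theorem lipschitzWith_one_of_edist_le_of_separating_eq_empty [Finite κ] (ℓ : κ → E →ᵃ[ℝ] ℝ)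
    {C : Set E} (hC : Convex ℝ C) {X : Type*} [PseudoEMetricSpace X] {f : C → X}
    (hf : ∀ P Q : C, separating ℓ P Q = ∅ → edist (f P) (f Q) ≤ edist P Q) :
    LipschitzWith 1 f := by
  suffices H : ∀ (m : ℕ) (P Q : C), (separating ℓ P Q).ncard = m →
      edist (f P) (f Q) ≤ edist P Q from
    LipschitzWith.of_edist_le fun P Q => H _ P Q rfl
  intro m
  induction m using Nat.strong_induction_on with
  | _ m ih =>
  rintro P Q rfl
  rcases (separating ℓ (P : E) Q).eq_empty_or_nonempty with hPQ | ⟨k, hk⟩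
  · exact hf P Q hPQ
  obtain ⟨t, ht, hk0⟩ := exists_apply_lineMap_eq_zero hk
  obtain ⟨R, hR⟩ : ∃ R : C, (R : E) = AffineMap.lineMap (P : E) Q t :=
    ⟨⟨_, hC.lineMap_mem P.2 Q.2 ht⟩, rfl⟩
  rw [← hR] at hk0
  have hPR : separating ℓ (P : E) R ⊂ separating ℓ (P : E) Q := by
    refine LE.le.ssubset_of_mem_notMem ?_ hk (by simp [mem_separating, hk0])
    rw [hR]
    exact separating_lineMap_subset ℓ _ _ ht
  have hRQ : separating ℓ (R : E) Q ⊂ separating ℓ (P : E) Q := by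
    refine LE.le.ssubset_of_mem_notMem ?_ hk (by simp [mem_separating, hk0])
    rw [separating_comm ℓ (R : E), separating_comm ℓ (P : E), hR, ← AffineMap.lineMap_apply_one_sub]
    exact separating_lineMap_subset ℓ _ _ (Set.Icc.mem_iff_one_sub_mem.1 ht)
  have hadd : edist P R + edist R Q = edist P Q := by
    simp only [edist_dist, ← ENNReal.ofReal_add dist_nonneg dist_nonneg]
    congr 1
    exact Wbtw.dist_add_dist (P := E) ⟨t, ht, hR.symm⟩
  calc edist (f P) (f Q) ≤ edist (f P) (f R) + edist (f R) (f Q) := edist_triangle _ _ _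
    _ ≤ edist P R + edist R Q :=
      add_le_add (ih _ (Set.ncard_lt_ncard hPR) P R rfl) (ih _ (Set.ncard_lt_ncard hRQ) R Q rfl)
    _ = edist P Q := hadd

end Chambers

section PadEnds

variable {α β : Type*} {n : ℕ}

/-- The tuple `(a, x 0, …, x (n - 1), b)`. -/
def padEnds (a b : α) (x : Fin n → α) : Fin (n + 2) → α := Fin.cons a (Fin.snoc x b)

@[simp] theorem padEnds_zero (a b : α) (x : Fin n → α) : padEnds a b x 0 = a := rfl

@[simp] theorem padEnds_last (a b : α) (x : Fin n → α) : padEnds a b x (Fin.last (n + 1)) = b := by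
  rw [← Fin.succ_last, padEnds, Fin.cons_succ, Fin.snoc_last]

@[simp] theorem padEnds_castSucc_succ (a b : α) (x : Fin n → α) (i : Fin n) :
    padEnds a b x i.castSucc.succ = x i := by
  rw [padEnds, Fin.cons_succ, Fin.snoc_castSucc]

theorem forall_fin_add_two_iff {p : Fin (n + 2) → Prop} :
    (∀ i, p i) ↔ p 0 ∧ (∀ i : Fin n, p i.castSucc.succ) ∧ p (Fin.last (n + 1)) := by
  rw [Fin.forall_fin_succ, Fin.forall_fin_succ', Fin.succ_last]

theorem exists_fin_add_two_iff {p : Fin (n + 2) → Prop} :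
    (∃ i, p i) ↔ p 0 ∨ (∃ i : Fin n, p i.castSucc.succ) ∨ p (Fin.last (n + 1)) := by
  rw [Fin.exists_fin_succ, Fin.exists_fin_succ', Fin.succ_last]

theorem padEnds_eq_iff {a b : α} {x : Fin n → α} {X : Fin (n + 2) → α} :
    padEnds a b x = X ↔
      a = X 0 ∧ (∀ i : Fin n, x i = X i.castSucc.succ) ∧ b = X (Fin.last (n + 1)) := by
  simp [funext_iff, forall_fin_add_two_iff]

theorem padEnds_inj {a b : α} {x y : Fin n → α} : padEnds a b x = padEnds a b y ↔ x = y := by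
  rw [padEnds_eq_iff]
  simp [funext_iff]

theorem comp_padEnds (g : α → β) (a b : α) (x : Fin n → α) :
    g ∘ padEnds a b x = padEnds (g a) (g b) (g ∘ x) :=
  (padEnds_eq_iff.2 (by simp)).symm

theorem monotone_of_monotone_padEnds [Preorder α] {a b : α} {x : Fin n → α}
    (h : Monotone (padEnds a b x)) : Monotone x := fun i j hij => by
  simpa using h (show i.castSucc.succ ≤ j.castSucc.succ by simpa using hij)

theorem mem_Icc_of_monotone_padEnds [Preorder α] {a b : α} {x : Fin n → α}
    (h : Monotone (padEnds a b x)) (i : Fin n) : x i ∈ Set.Icc a b :=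
  ⟨by simpa using h (Fin.zero_le i.castSucc.succ), by simpa using h (Fin.le_last i.castSucc.succ)⟩

theorem monotone_padEnds [Preorder α] {a b : α} (hab : a ≤ b) {x : Fin n → α} (hx : Monotone x)
    (hmem : ∀ i, x i ∈ Set.Icc a b) : Monotone (padEnds a b x) := by
  have hle (i : Fin (n + 2)) : a ≤ padEnds a b x i ∧ padEnds a b x i ≤ b := by
    revert i
    simpa [forall_fin_add_two_iff, hab] using hmem
  intro i
  revert i
  refine forall_fin_add_two_iff.2 ⟨fun j _ => (hle j).1, fun i => ?_, fun j hj => ?_⟩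
  · refine forall_fin_add_two_iff.2 ⟨fun h => absurd h (by simp), fun j hij => ?_,
      fun _ => by simpa using (hmem i).2⟩
    simpa using hx (by simpa using hij)
  · rw [Fin.last_le_iff.1 hj]

end PadEnds

section MonotoneSimplex

variable {n : ℕ} {a b : ℝ}

/-- The simplex of all tuples `a ≤ x 0 ≤ ⋯ ≤ x (n - 1) ≤ b`. -/
def monoSimplex (a b : ℝ) (n : ℕ) : Set (EuclideanSpace ℝ (Fin n)) :=
  {x | Monotone (padEnds a b x)}

/-- The smallest face of `monoSimplex a b n` containing `x`: the tuples satisfying all the equations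
that `x` satisfies between two of its entries, or between an entry and one of `a` and `b`. -/
def monoFace (a b : ℝ) (x : EuclideanSpace ℝ (Fin n)) : Set (EuclideanSpace ℝ (Fin n)) :=
  {y ∈ monoSimplex a b n | (padEnds a b y).FactorsThrough (padEnds a b x)}

/-- The differences of two entries of the padded tuple, the larger index minus the smaller one. -/
noncomputable def padDiff (a b : ℝ) (p : {p : Fin (n + 2) × Fin (n + 2) // p.1 ≤ p.2}) :
    EuclideanSpace ℝ (Fin n) →ᴬ[ℝ] ℝ :=
  let coord := padEnds (ContinuousAffineMap.const ℝ _ a) (ContinuousAffineMap.const ℝ _ b)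
    fun i => (EuclideanSpace.proj i).toContinuousAffineMap
  coord p.1.2 - coord p.1.1

theorem padDiff_apply (p : {p : Fin (n + 2) × Fin (n + 2) // p.1 ≤ p.2})
    (x : EuclideanSpace ℝ (Fin n)) :
    padDiff a b p x = padEnds a b x p.1.2 - padEnds a b x p.1.1 :=
  congrArg₂ (· - ·) (congrFun (comp_padEnds (fun f : _ →ᴬ[ℝ] ℝ => f x) _ _ _) p.1.2)
    (congrFun (comp_padEnds (fun f : _ →ᴬ[ℝ] ℝ => f x) _ _ _) p.1.1)

theorem polyhedron_padDiff : polyhedron (padDiff (n := n) a b) = monoSimplex a b n := by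
  ext x
  simp only [polyhedron, monoSimplex, Set.mem_ofPred_eq, padDiff_apply, sub_nonneg, Subtype.forall,
    Prod.forall]
  rfl

theorem tightFace_padDiff (x : EuclideanSpace ℝ (Fin n)) :
    tightFace (padDiff a b) x = monoFace a b x := by
  ext y
  simp only [tightFace, monoFace, polyhedron_padDiff, Set.mem_ofPred_eq, padDiff_apply, sub_eq_zero,
    Subtype.forall, Prod.forall]
  refine and_congr_right fun _ => ⟨fun h i j hij => ?_, fun h i j _ hij => h hij⟩
  rcases le_total i j with hle | hle
  · exact (h i j hle hij.symm).symm
  · exact h j i hle hij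

/-- The tuple with `m` entries `a` followed by entries `b`. -/
noncomputable def stepTuple (a b : ℝ) (m : Fin (n + 1)) : EuclideanSpace ℝ (Fin n) :=
  WithLp.toLp 2 fun i => if m ≤ i.castSucc then b else a

theorem stepTuple_mem_monoSimplex (hab : a ≤ b) (m : Fin (n + 1)) :
    stepTuple a b m ∈ monoSimplex a b n := by
  refine monotone_padEnds hab (fun i j hij => ?_) (fun i => ?_) <;> simp only [stepTuple]
  · split_ifs with hi hj
    · exact le_rfl
    · exact absurd (hi.trans (Fin.castSucc_le_castSucc_iff.2 hij)) hj
    · exact hab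
    · exact le_rfl
  · split_ifs <;> simp [hab]

theorem sum_succ_sub_castSucc (X : Fin (n + 2) → ℝ) :
    ∑ m : Fin (n + 1), (X m.succ - X m.castSucc) = X (Fin.last (n + 1)) - X 0 := by
  rw [← Fin.succ_last, ← Fin.sum_Iic_sub, ← Fin.top_eq_last, Finset.Iic_top]

/-- The barycentric coordinates of a point of `monoSimplex a b n` are the increments of the padded
tuple, up to the factor `b - a`. -/
theorem sum_smul_stepTuple (hab : a < b) (x : EuclideanSpace ℝ (Fin n)) :
    ∑ m : Fin (n + 1), ((padEnds a b x m.succ - padEnds a b x m.castSucc) / (b - a)) •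
      stepTuple a b m = x := by
  set X := padEnds a b x
  have hba : b - a ≠ 0 := (sub_pos.2 hab).ne'
  ext i
  have hterm (m : Fin (n + 1)) : (X m.succ - X m.castSucc) / (b - a) * stepTuple a b m i =
      (X m.succ - X m.castSucc) * (a / (b - a)) +
        if m ≤ i.castSucc then X m.succ - X m.castSucc else 0 := by
    simp only [stepTuple]
    split_ifs <;> field_simp <;> ring
  have hall : ∑ m : Fin (n + 1), (X m.succ - X m.castSucc) = b - a := by
    simp only [sum_succ_sub_castSucc, X, padEnds_zero, padEnds_last]
  have hinit : ∑ m with m ≤ i.castSucc, (X m.succ - X m.castSucc) = x i - a := by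
    rw [Finset.filter_ge_eq_Iic, Fin.sum_Iic_sub]
    simp only [X, padEnds_zero, padEnds_castSucc_succ]
  simp only [WithLp.ofLp_sum, WithLp.ofLp_smul, Finset.sum_apply, Pi.smul_apply, smul_eq_mul, hterm]
  rw [Finset.sum_add_distrib, ← Finset.sum_mul, ← Finset.sum_filter, hall, hinit,
    mul_div_cancel₀ _ hba, add_sub_cancel]

theorem convexHull_range_stepTuple (hab : a < b) :
    convexHull ℝ (Set.range (stepTuple a b)) = monoSimplex a b n := by
  refine (convexHull_min ?_ ?_).antisymm fun x hx => ?_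
  · exact Set.range_subset_iff.2 (stepTuple_mem_monoSimplex hab.le)
  · exact polyhedron_padDiff ▸ convex_polyhedron _
  have hba : 0 < b - a := sub_pos.2 hab
  rw [← sum_smul_stepTuple hab x]
  refine (convex_convexHull ℝ _).sum_mem (fun m _ => ?_) ?_
    fun m _ => subset_convexHull ℝ _ ⟨m, rfl⟩
  · exact div_nonneg (sub_nonneg.2 (hx (Fin.castSucc_le_succ m))) hba.le
  · rw [← Finset.sum_div, div_eq_one_iff_eq hba.ne']
    simp only [sum_succ_sub_castSucc, padEnds_zero, padEnds_last]

theorem isOrthoscheme_image_diagonal (hab : a < b) {w : Fin n → ℝ} (hw : ∀ i, w i ≠ 0) :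
    IsOrthoscheme n ((Matrix.diagonal w).toEuclideanLin '' monoSimplex a b n) := by
  refine ⟨(Matrix.diagonal w).toEuclideanLin (stepTuple a b 0),
    fun i => EuclideanSpace.single i (w i * (a - b)), fun i => ?_, fun i j hij => ?_, ?_⟩
  · simp [hw i, sub_eq_zero, hab.ne]
  · simp [EuclideanSpace.inner_single_left, hij]
  · rw [← convexHull_range_stepTuple hab, LinearMap.image_convexHull, ← Set.range_comp]
    congr 2
    funext m
    ext j
    simp only [Function.comp_apply, Matrix.toLpLin_apply, Matrix.mulVec_diagonal, stepTuple,
      Fin.zero_le, if_true, PiLp.add_apply, WithLp.ofLp_sum, Finset.sum_apply, PiLp.single_apply,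
      Finset.sum_ite_eq, Finset.mem_filter, Finset.mem_univ, true_and, ← not_le, ite_not]
    split_ifs <;> ring

end MonotoneSimplex

section MonotoneSurjection

variable {p q : ℕ}

theorem map_zero_of_monotone_surjective {ρ : Fin (p + 1) → Fin (q + 1)} (hm : Monotone ρ)
    (hs : ρ.Surjective) : ρ 0 = 0 := by
  obtain ⟨i, hi⟩ := hs 0
  exact Fin.le_zero_iff.1 (hi ▸ hm (Fin.zero_le i))

theorem map_last_of_monotone_surjective {ρ : Fin (p + 1) → Fin (q + 1)} (hm : Monotone ρ)
    (hs : ρ.Surjective) : ρ (Fin.last p) = Fin.last q := by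
  obtain ⟨i, hi⟩ := hs (Fin.last q)
  exact Fin.last_le_iff.1 (hi ▸ hm (Fin.le_last i))

theorem eq_id_of_monotone_surjective {ρ : Fin p → Fin p} (hm : Monotone ρ) (hs : ρ.Surjective) :
    ρ = id := by
  have hρ : StrictMono ρ := hm.strictMono_of_injective (Finite.injective_iff_surjective.2 hs)
  exact (hρ.range_inj strictMono_id).1 (by rw [hs.range_eq, Set.range_id])

theorem exists_eq_comp_predAbove {ρ : Fin (p + 1) → Fin q} (hm : Monotone ρ) (hs : ρ.Surjective)
    (hq : q ≤ p) : ∃ (i : Fin p) (ρ' : Fin p → Fin q),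
      Monotone ρ' ∧ ρ'.Surjective ∧ ρ = ρ' ∘ i.predAbove := by
  obtain ⟨i, hi⟩ : ∃ i : Fin p, ρ i.castSucc = ρ i.succ := by
    by_contra! hne
    have hρ : StrictMono ρ := Fin.strictMono_iff_lt_succ.2 fun i =>
      (hm (Fin.castSucc_le_succ i)).lt_of_ne (hne i)
    exact hq.not_gt (Fin.le_of_injective ρ hρ.injective)
  have hρ : ρ = (ρ ∘ i.succ.succAbove) ∘ i.predAbove := by
    funext j
    rcases eq_or_ne j i.succ with rfl | hj
    · simp [hi]
    · simp [Fin.succ_succAbove_predAbove hj]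
  exact ⟨i, _, hm.comp (Fin.strictMono_succAbove _).monotone, (hρ ▸ hs).of_comp, hρ⟩

theorem exists_monotone_eq_comp {ι κ α : Type*} [LinearOrder ι] [PartialOrder κ] [Preorder α]
    {r : ι → κ} {f : ι → α} (hr : Monotone r) (hrs : r.Surjective) (hf : Monotone f)
    (hfr : f.FactorsThrough r) : ∃ f' : κ → α, Monotone f' ∧ f = f' ∘ r := by
  choose g hg using hrs
  refine ⟨f ∘ g, fun i j hij => ?_, funext fun i => hfr (hg (r i)).symm⟩
  rcases le_total (g i) (g j) with h | h
  · exact hf h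
  · rw [hij.antisymm (hg i ▸ hg j ▸ hr h)]

end MonotoneSurjection

section CountMatrix

variable {n p q : ℕ}

/-- The matrix counting how often each pair of indices occurs in two tuples of indices. -/
def countMatrix (r : Fin n → Fin p) (s : Fin n → Fin q) : Matrix (Fin p) (Fin q) ℕ :=
  fun i j => Finset.card {t | r t = i ∧ s t = j}

theorem sum_countMatrix_row (r : Fin n → Fin p) (s : Fin n → Fin q) (i : Fin p) :
    ∑ j, countMatrix r s i j = Finset.card {t | r t = i} := by
  rw [Finset.card_eq_sum_card_fiberwise (f := s) (t := Finset.univ) (by simp)]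
  simp only [countMatrix, Finset.filter_filter]

theorem sum_countMatrix_col (r : Fin n → Fin p) (s : Fin n → Fin q) (j : Fin q) :
    ∑ i, countMatrix r s i j = Finset.card {t | s t = j} := by
  rw [Finset.card_eq_sum_card_fiberwise (f := r) (t := Finset.univ) (by simp)]
  simp only [countMatrix, Finset.filter_filter, and_comm]

theorem sum_countMatrix (r : Fin n → Fin p) (s : Fin n → Fin q) :
    ∑ i, ∑ j, countMatrix r s i j = n := by
  simp only [sum_countMatrix_row]
  rw [← Finset.card_eq_sum_card_fiberwise (by simp), Finset.card_fin]

theorem exists_eq_countMatrix (M : Matrix (Fin p) (Fin q) ℕ) (hM : ∑ i, ∑ j, M i j = n) :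
    ∃ (r : Fin n → Fin p) (s : Fin n → Fin q), M = countMatrix r s := by
  have hcard : Fintype.card (Σ c : Fin p × Fin q, Fin (M c.1 c.2)) = n := by
    simpa [Fintype.sum_prod_type] using hM
  let e := (Fintype.equivFinOfCardEq hcard).symm
  refine ⟨fun t => (e t).1.1, fun t => (e t).1.2, funext₂ fun i j => ?_⟩
  have fiber : {t // (e t).1.1 = i ∧ (e t).1.2 = j} ≃ Fin (M i j) :=
    (e.subtypeEquiv fun t => (Prod.ext_iff (y := (i, j))).symm).trans (Equiv.sigmaSubtype (i, j))
  rw [countMatrix, ← Fintype.card_subtype, Fintype.card_congr fiber, Fintype.card_fin]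

theorem countMatrix_comp_perm (r : Fin n → Fin p) (s : Fin n → Fin q)
    (σ : Equiv.Perm (Fin n)) : countMatrix (r ∘ σ) (s ∘ σ) = countMatrix r s :=
  funext₂ fun _ _ => Finset.card_equiv σ (by simp)

theorem nat_card_eq_countMatrix (r : Fin n → Fin p) (s : Fin n → Fin q) (i : Fin p)
    (j : Fin q) : Nat.card {t // (r t, s t) = (i, j)} = countMatrix r s i j := by
  simp only [Prod.mk.injEq, Nat.card_eq_fintype_card, Fintype.card_subtype, countMatrix]

theorem exists_perm_comp_eq_of_card_fiber_eq {ι κ X : Type*} [Finite ι] {f : κ → X}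
    (hf : f.Injective) {c : ι → κ} {z : ι → X}
    (h : ∀ k, Nat.card {t // c t = k} = Nat.card {t // z t = f k}) :
    ∃ σ : Equiv.Perm ι, z ∘ σ = f ∘ c := by
  let e (k : κ) : {t // c t = k} ≃ {t // z t = f k} := (Finite.card_eq.1 (h k)).some
  let F (t : ι) : ι := e (c t) ⟨t, rfl⟩
  have hF (t : ι) : z (F t) = f (c t) := (e (c t) ⟨t, rfl⟩).2
  have hFe {t : ι} {k : κ} (hk : c t = k) : F t = e k ⟨t, hk⟩ := by
    subst hk
    rfl
  have hinj : F.Injective := fun t t' htt' => by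
    have hc : c t = c t' := hf (by rw [← hF, htt', hF])
    rw [hFe hc, hFe (rfl : c t' = c t')] at htt'
    exact congrArg Subtype.val ((e (c t')).injective (Subtype.ext htt'))
  exact ⟨Equiv.ofBijective F (Finite.injective_iff_bijective.1 hinj), funext hF⟩

theorem exists_perm_of_countMatrix_eq {r r' : Fin n → Fin p} {s s' : Fin n → Fin q}
    (h : countMatrix r s = countMatrix r' s') :
    ∃ σ : Equiv.Perm (Fin n), r = r' ∘ σ ∧ s = s' ∘ σ := by
  obtain ⟨σ, hσ⟩ := exists_perm_comp_eq_of_card_fiber_eq (c := fun t => (r t, s t))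
    (z := fun t => (r' t, s' t)) Function.injective_id fun c => by
      simp only [id_eq, nat_card_eq_countMatrix, h]
  exact ⟨σ, funext fun t => (congrArg Prod.fst (congrFun hσ t)).symm,
    funext fun t => (congrArg Prod.snd (congrFun hσ t)).symm⟩

theorem rowMerge_countMatrix {h k : ℕ} (i : Fin (h + 2)) (r : Fin n → Fin (h + 3))
    (s : Fin n → Fin (k + 2)) :
    rowMerge i (countMatrix r s) = countMatrix (i.predAbove ∘ r) s := by
  funext a b
  simp only [rowMerge, countMatrix, Function.comp_apply]
  rw [← Finset.card_biUnion fun i' _ j' _ hij =>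
    Finset.disjoint_filter.2 fun t _ ht ht' => hij (ht.1.symm.trans ht'.1)]
  congr 1
  ext t
  simp

theorem colMerge_countMatrix {h k : ℕ} (i : Fin (k + 2)) (r : Fin n → Fin (h + 2))
    (s : Fin n → Fin (k + 3)) :
    colMerge i (countMatrix r s) = countMatrix r (i.predAbove ∘ s) := by
  funext a b
  simp only [colMerge, countMatrix, Function.comp_apply]
  rw [← Finset.card_biUnion fun i' _ j' _ hij =>
    Finset.disjoint_filter.2 fun t _ ht ht' => hij (ht.2.symm.trans ht'.2)]
  congr 1
  ext t
  simp [and_comm]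

/-- All indices but possibly the first and the last one occur in `r`. -/
def CoversInterior {h : ℕ} (r : Fin n → Fin (h + 2)) : Prop :=
  (padEnds 0 (Fin.last (h + 1)) r).Surjective

theorem coversInterior_iff {h : ℕ} {r : Fin n → Fin (h + 2)} :
    CoversInterior r ↔ ∀ i, i ≠ 0 → i ≠ Fin.last (h + 1) → ∃ t, r t = i := by
  refine forall_congr' fun i => ?_
  simp only [exists_fin_add_two_iff, padEnds_zero, padEnds_last, padEnds_castSucc_succ,
    eq_comm (b := i)]
  tauto

theorem comp_padEnds_of_monotone_surjective {h h' : ℕ} {ρ : Fin (h + 2) → Fin (h' + 2)}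
    (hm : Monotone ρ) (hs : ρ.Surjective) (r : Fin n → Fin (h + 2)) :
    ρ ∘ padEnds 0 (Fin.last (h + 1)) r = padEnds 0 (Fin.last (h' + 1)) (ρ ∘ r) := by
  rw [comp_padEnds, map_zero_of_monotone_surjective hm hs, map_last_of_monotone_surjective hm hs]

theorem CoversInterior.comp {h h' : ℕ} {ρ : Fin (h + 2) → Fin (h' + 2)} {r : Fin n → Fin (h + 2)}
    (hr : CoversInterior r) (hm : Monotone ρ) (hs : ρ.Surjective) : CoversInterior (ρ ∘ r) := by
  rw [CoversInterior, ← comp_padEnds_of_monotone_surjective hm hs]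
  exact Function.Surjective.comp hs hr

theorem isRectComposition_countMatrix_iff {h k : ℕ} {r : Fin n → Fin (h + 2)}
    {s : Fin n → Fin (k + 2)} :
    IsRectComposition n (countMatrix r s) ↔ CoversInterior r ∧ CoversInterior s := by
  have hrow (i) : 0 < ∑ j, countMatrix r s i j ↔ ∃ t, r t = i := by
    simp [sum_countMatrix_row, Finset.card_pos, Finset.filter_nonempty_iff]
  have hcol (j) : 0 < ∑ i, countMatrix r s i j ↔ ∃ t, s t = j := by
    simp [sum_countMatrix_col, Finset.card_pos, Finset.filter_nonempty_iff]
  simp only [coversInterior_iff, ← hrow, ← hcol]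
  exact ⟨fun H => ⟨H.row_pos, H.col_pos⟩, fun H => ⟨H.1, H.2, sum_countMatrix r s⟩⟩

end CountMatrix

namespace RectComp

variable {n h k : ℕ} {r : Fin n → Fin (h + 2)} {s : Fin n → Fin (k + 2)}

/-- The rectangular composition that counts how often each pair of indices occurs in `r` and `s`. -/
def ofIndices (r : Fin n → Fin (h + 2)) (s : Fin n → Fin (k + 2)) (hr : CoversInterior r)
    (hs : CoversInterior s) : RectComp n :=
  ⟨h, k, countMatrix r s, isRectComposition_countMatrix_iff.2 ⟨hr, hs⟩⟩

theorem exists_eq_ofIndices (a : RectComp n) :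
    ∃ (r : Fin n → Fin (a.h + 2)) (s : Fin n → Fin (a.k + 2)) (hr : CoversInterior r)
      (hs : CoversInterior s), a = ofIndices r s hr hs := by
  obtain ⟨h, k, M, hM⟩ := a
  obtain ⟨r, s, rfl⟩ := exists_eq_countMatrix M hM.sum_eq
  obtain ⟨hr, hs⟩ := isRectComposition_countMatrix_iff.1 hM
  exact ⟨r, s, hr, hs, rfl⟩

theorem ofIndices_comp_left_le {h' : ℕ} (hr : CoversInterior r) (hs : CoversInterior s)
    {ρ : Fin (h + 2) → Fin (h' + 2)} (hm : Monotone ρ) (hsurj : ρ.Surjective) :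
    ofIndices (ρ ∘ r) s (hr.comp hm hsurj) hs ≤ ofIndices r s hr hs := by
  induction h with
  | zero =>
    obtain rfl : h' = 0 := by simpa using Fin.le_of_surjective _ hsurj
    obtain rfl := eq_id_of_monotone_surjective hm hsurj
    exact le_rfl
  | succ m ih =>
    rcases (Nat.add_le_add_iff_right.1 (Fin.le_of_surjective _ hsurj)).eq_or_lt with rfl | hlt
    · obtain rfl := eq_id_of_monotone_surjective hm hsurj
      exact le_rfl
    obtain ⟨i, ρ', hm', hsurj', rfl⟩ := exists_eq_comp_predAbove hm hsurj (by omega)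
    have hi : CoversInterior (i.predAbove ∘ r) :=
      hr.comp (Fin.predAbove_right_monotone i) i.predAbove_surjective
    have hmerge : Merge (ofIndices r s hr hs) (ofIndices (i.predAbove ∘ r) s hi hs) := by
      simp only [ofIndices, ← rowMerge_countMatrix]
      exact Merge.row i _ _ _
    exact (ih hi hm' hsurj').trans (Relation.ReflTransGen.single hmerge)

theorem ofIndices_comp_right_le {k' : ℕ} (hr : CoversInterior r) (hs : CoversInterior s)
    {γ : Fin (k + 2) → Fin (k' + 2)} (hm : Monotone γ) (hsurj : γ.Surjective) :
    ofIndices r (γ ∘ s) hr (hs.comp hm hsurj) ≤ ofIndices r s hr hs := by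
  induction k with
  | zero =>
    obtain rfl : k' = 0 := by simpa using Fin.le_of_surjective _ hsurj
    obtain rfl := eq_id_of_monotone_surjective hm hsurj
    exact le_rfl
  | succ m ih =>
    rcases (Nat.add_le_add_iff_right.1 (Fin.le_of_surjective _ hsurj)).eq_or_lt with rfl | hlt
    · obtain rfl := eq_id_of_monotone_surjective hm hsurj
      exact le_rfl
    obtain ⟨j, γ', hm', hsurj', rfl⟩ := exists_eq_comp_predAbove hm hsurj (by omega)
    have hj : CoversInterior (j.predAbove ∘ s) :=
      hs.comp (Fin.predAbove_right_monotone j) j.predAbove_surjective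
    have hmerge : Merge (ofIndices r s hr hs) (ofIndices r (j.predAbove ∘ s) hr hj) := by
      simp only [ofIndices, ← colMerge_countMatrix]
      exact Merge.col j _ _ _
    exact (ih hj hm' hsurj').trans (Relation.ReflTransGen.single hmerge)

theorem le_ofIndices_iff {a : RectComp n} (hr : CoversInterior r) (hs : CoversInterior s) :
    a ≤ ofIndices r s hr hs ↔
      ∃ (ρ : Fin (h + 2) → Fin (a.h + 2)) (γ : Fin (k + 2) → Fin (a.k + 2)),
        (Monotone ρ ∧ ρ.Surjective) ∧ (Monotone γ ∧ γ.Surjective) ∧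
          a.mat = countMatrix (ρ ∘ r) (γ ∘ s) := by
  constructor
  · intro hle
    change Relation.ReflTransGen Merge _ a at hle
    induction hle with
    | refl =>
      exact ⟨id, id, ⟨monotone_id, Function.surjective_id⟩,
        ⟨monotone_id, Function.surjective_id⟩, rfl⟩
    | tail _ hmerge ih =>
      obtain ⟨ρ, γ, hρ, hγ, hb⟩ := ih
      cases hmerge with
      | row i M hM hN =>
        dsimp only at ρ γ hρ hγ hb
        subst hb
        exact ⟨i.predAbove ∘ ρ, γ, ⟨(Fin.predAbove_right_monotone i).comp hρ.1,
          i.predAbove_surjective.comp hρ.2⟩, hγ, rowMerge_countMatrix i _ _⟩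
      | col j M hM hN =>
        dsimp only at ρ γ hρ hγ hb
        subst hb
        exact ⟨ρ, j.predAbove ∘ γ, hρ, ⟨(Fin.predAbove_right_monotone j).comp hγ.1,
          j.predAbove_surjective.comp hγ.2⟩, colMerge_countMatrix j _ _⟩
  · obtain ⟨h', k', M, hM⟩ := a
    rintro ⟨ρ, γ, hρ, hγ, ha⟩
    dsimp only at ρ γ hρ hγ ha
    subst ha
    exact (ofIndices_comp_left_le hr (hs.comp hγ.1 hγ.2) hρ.1 hρ.2).trans
      (ofIndices_comp_right_le hr hs hγ.1 hγ.2)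

end RectComp

section Grid

variable {α : Type*} [LinearOrder α]

theorem exists_strictMono_surjective_comp {ι : Type*} [Finite ι] (X : ι → α) :
    ∃ (m : ℕ) (g : Fin m → α) (R : ι → Fin m), StrictMono g ∧ R.Surjective ∧ X = g ∘ R := by
  have := Fintype.ofFinite ι
  let g := (Finset.univ.image X).orderEmbOfFin rfl
  have hg : Set.range g = Set.range X := by simp [g]
  choose R hR using fun i => hg.ge (Set.mem_range_self i)
  refine ⟨_, g, R, g.strictMono, fun j => ?_, funext fun i => (hR i).symm⟩
  obtain ⟨i, hi⟩ := hg.le (Set.mem_range_self j)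
  exact ⟨i, g.injective ((hR i).trans hi)⟩

variable {a b : α} {n h h' : ℕ} {x x' : Fin n → α} {g : Fin (h + 2) → α} {g' : Fin (h' + 2) → α}
  {r : Fin n → Fin (h + 2)} {r' : Fin n → Fin (h' + 2)}

/-- The strictly increasing tuple `g` lists the elements of `{a, b} ∪ {x t | t}` from `a` to `b`,
and `r t` is the position of `x t` in `g`. -/
structure IsGrid (a b : α) (x : Fin n → α) (g : Fin (h + 2) → α) (r : Fin n → Fin (h + 2)) :
    Prop where
  strictMono : StrictMono g
  coversInterior : CoversInterior r
  padEnds_eq : padEnds a b x = g ∘ padEnds 0 (Fin.last (h + 1)) r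

theorem isGrid_iff : IsGrid a b x g r ↔
    StrictMono g ∧ CoversInterior r ∧ g 0 = a ∧ g (Fin.last (h + 1)) = b ∧ x = g ∘ r := by
  have hpad : padEnds a b x = g ∘ padEnds 0 (Fin.last (h + 1)) r ↔
      g 0 = a ∧ g (Fin.last (h + 1)) = b ∧ x = g ∘ r := by
    rw [comp_padEnds, padEnds_eq_iff, padEnds_zero, padEnds_last, funext_iff]
    simp only [padEnds_castSucc_succ]
    tauto
  exact ⟨fun ⟨hg, hr, hx⟩ => ⟨hg, hr, hpad.1 hx⟩, fun ⟨hg, hr, hx⟩ => ⟨hg, hr, hpad.2 hx⟩⟩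

theorem exists_isGrid (hab : a < b) (hx : ∀ t, x t ∈ Set.Icc a b) :
    ∃ (h : ℕ) (g : Fin (h + 2) → α) (r : Fin n → Fin (h + 2)), IsGrid a b x g r := by
  obtain ⟨m, g, R, hg, hR, hX⟩ := exists_strictMono_surjective_comp (padEnds a b x)
  have hXR (i) : padEnds a b x i = g (R i) := congrFun hX i
  have hbounds : ∀ i, a ≤ padEnds a b x i ∧ padEnds a b x i ≤ b :=
    forall_fin_add_two_iff.2 ⟨by simp [hab.le], by simpa using hx, by simp [hab.le]⟩
  have hlt : R 0 < R (Fin.last (n + 1)) := hg.lt_iff_lt.1 (by simpa [← hXR] using hab)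
  obtain ⟨h, rfl⟩ : ∃ h, m = h + 2 := ⟨m - 2, by omega⟩
  have hR0 : R 0 = 0 := by
    obtain ⟨i, hi⟩ := hR 0
    refine Fin.le_zero_iff.1 (hg.le_iff_le.1 ?_)
    rw [← hi, ← hXR, ← hXR]
    exact (hbounds i).1
  have hRlast : R (Fin.last (n + 1)) = Fin.last (h + 1) := by
    obtain ⟨i, hi⟩ := hR (Fin.last (h + 1))
    refine Fin.last_le_iff.1 (hg.le_iff_le.1 ?_)
    rw [← hi, ← hXR, ← hXR, padEnds_last]
    exact (hbounds i).2
  have hpad : padEnds 0 (Fin.last (h + 1)) (fun t => R t.castSucc.succ) = R :=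
    padEnds_eq_iff.2 ⟨hR0.symm, fun _ => rfl, hRlast.symm⟩
  exact ⟨h, g, _, hg, hpad.symm ▸ hR, hpad.symm ▸ hX⟩

namespace IsGrid

theorem mem_Icc (H : IsGrid a b x g r) (t : Fin n) : x t ∈ Set.Icc a b := by
  obtain ⟨hg, -, rfl, rfl, rfl⟩ := isGrid_iff.1 H
  exact ⟨hg.monotone (Fin.zero_le _), hg.monotone (Fin.le_last _)⟩

theorem range_eq (H : IsGrid a b x g r) : Set.range g = Set.range (padEnds a b x) := by
  rw [H.padEnds_eq, Set.range_comp, Function.Surjective.range_eq H.coversInterior, Set.image_univ]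

theorem sigma_eq (H : IsGrid a b x g r) (H' : IsGrid a b x g' r') :
    (⟨h, r⟩ : Σ h, Fin n → Fin (h + 2)) = ⟨h', r'⟩ := by
  have hrange : Set.range g = Set.range g' := H.range_eq.trans H'.range_eq.symm
  obtain rfl : h = h' := by
    have hcard := congrArg Set.ncard hrange
    rw [Set.ncard_range_of_injective H.strictMono.injective,
      Set.ncard_range_of_injective H'.strictMono.injective] at hcard
    simpa using hcard
  obtain rfl := (H.strictMono.range_inj H'.strictMono).1 hrange
  obtain ⟨-, -, -, -, hx⟩ := isGrid_iff.1 H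
  obtain ⟨-, -, -, -, hx'⟩ := isGrid_iff.1 H'
  rw [H.strictMono.injective.comp_left (hx.symm.trans hx')]

theorem comp_perm (H : IsGrid a b x g r) (σ : Equiv.Perm (Fin n)) :
    IsGrid a b (x ∘ σ) g (r ∘ σ) := by
  obtain ⟨hg, hr, h0, h1, rfl⟩ := isGrid_iff.1 H
  refine isGrid_iff.2 ⟨hg, coversInterior_iff.2 fun i hi hi' => ?_, h0, h1, rfl⟩
  obtain ⟨t, ht⟩ := coversInterior_iff.1 hr i hi hi'
  exact ⟨σ.symm t, by simpa using ht⟩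

theorem monotone_iff (H : IsGrid a b x g r) :
    Monotone (padEnds a b x) ↔ Monotone (padEnds 0 (Fin.last (h + 1)) r) := by
  simp only [H.padEnds_eq, Monotone, Function.comp_apply, H.strictMono.le_iff_le]

theorem factorsThrough_iff {β : Type*} (H : IsGrid a b x g r) {f : Fin (n + 2) → β} :
    f.FactorsThrough (padEnds a b x) ↔ f.FactorsThrough (padEnds 0 (Fin.last (h + 1)) r) := by
  simp only [H.padEnds_eq, Function.FactorsThrough, Function.comp_apply,
    H.strictMono.injective.eq_iff]

theorem exists_eq_comp (H : IsGrid a b x g r) (H' : IsGrid a b x' g' r')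
    (hx : Monotone (padEnds a b x)) (hx' : Monotone (padEnds a b x'))
    (hf : (padEnds a b x').FactorsThrough (padEnds a b x)) :
    ∃ ρ : Fin (h + 2) → Fin (h' + 2), (Monotone ρ ∧ ρ.Surjective) ∧ r' = ρ ∘ r := by
  have hf' : (padEnds 0 (Fin.last (h' + 1)) r').FactorsThrough
      (padEnds 0 (Fin.last (h + 1)) r) := fun i j hij =>
    H'.strictMono.injective (by simpa [H'.padEnds_eq] using H.factorsThrough_iff.1 hf hij)
  obtain ⟨ρ, hρ, hr'⟩ :=
    exists_monotone_eq_comp (H.monotone_iff.1 hx) H.coversInterior (H'.monotone_iff.1 hx') hf'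
  have hsurj : (padEnds 0 (Fin.last (h' + 1)) r').Surjective := H'.coversInterior
  replace hsurj : ρ.Surjective := .of_comp (hr' ▸ hsurj)
  rw [comp_padEnds_of_monotone_surjective hρ hsurj, padEnds_inj] at hr'
  exact ⟨ρ, ⟨hρ, hsurj⟩, hr'⟩

theorem collapse (H : IsGrid a b x g r) (hx : Monotone (padEnds a b x))
    {ρ : Fin (h + 2) → Fin (h' + 2)} (hρ : Monotone ρ) (hsurj : ρ.Surjective)
    (hg' : StrictMono g') (h0 : g' 0 = a) (h1 : g' (Fin.last (h' + 1)) = b) :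
    IsGrid a b (g' ∘ ρ ∘ r) g' (ρ ∘ r) ∧ Monotone (padEnds a b (g' ∘ ρ ∘ r)) ∧
      (padEnds a b (g' ∘ ρ ∘ r)).FactorsThrough (padEnds a b x) := by
  have H' : IsGrid a b (g' ∘ ρ ∘ r) g' (ρ ∘ r) :=
    isGrid_iff.2 ⟨hg', H.coversInterior.comp hρ hsurj, h0, h1, rfl⟩
  have hpad := comp_padEnds_of_monotone_surjective hρ hsurj r
  refine ⟨H', H'.monotone_iff.2 ?_, H.factorsThrough_iff.2 ?_⟩
  · rw [← hpad]
    exact hρ.comp (H.monotone_iff.1 hx)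
  · intro i j hij
    rw [H'.padEnds_eq, ← hpad]
    simp only [Function.comp_apply, hij]

end IsGrid

end Grid

section FaceShape

variable {a b : ℝ} {n d : ℕ}

/-- The tuple `t ↦ padEnds a b y (r t)`, in which the entries of `y`, `a` and `b` are repeated as
prescribed by the indices `r`. -/
def repeatEntries (a b : ℝ) (r : Fin n → Fin (d + 2)) (y : EuclideanSpace ℝ (Fin d)) :
    EuclideanSpace ℝ (Fin n) :=
  WithLp.toLp 2 (padEnds a b y ∘ r)

theorem padEnds_repeatEntries (r : Fin n → Fin (d + 2)) (y : EuclideanSpace ℝ (Fin d)) :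
    padEnds a b (repeatEntries a b r y) = padEnds a b y ∘ padEnds 0 (Fin.last (d + 1)) r := by
  simp [comp_padEnds, repeatEntries]

theorem IsGrid.repeatEntries_image_monoSimplex {x : EuclideanSpace ℝ (Fin n)} {g : Fin (d + 2) → ℝ}
    {r : Fin n → Fin (d + 2)} (H : IsGrid a b x g r) (hx : x ∈ monoSimplex a b n) :
    repeatEntries a b r '' monoSimplex a b d = monoFace a b x := by
  have hr := H.monotone_iff.1 hx
  ext x'
  constructor
  · rintro ⟨y, hy, rfl⟩
    refine ⟨?_, H.factorsThrough_iff.2 fun i j hij => ?_⟩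
    · rw [monoSimplex, Set.mem_ofPred_eq, padEnds_repeatEntries]
      exact Monotone.comp hy hr
    · simp only [padEnds_repeatEntries, Function.comp_apply, hij]
  · rintro ⟨hx', hf⟩
    obtain ⟨f, hf, hx'f⟩ :=
      exists_monotone_eq_comp hr H.coversInterior hx' (H.factorsThrough_iff.1 hf)
    have hpad : padEnds a b (fun j : Fin d => f j.castSucc.succ) = f :=
      padEnds_eq_iff.2 ⟨by simpa using congrFun hx'f 0, fun _ => rfl,
        by simpa using congrFun hx'f (Fin.last _)⟩
    have hmem : WithLp.toLp 2 (fun j : Fin d => f j.castSucc.succ) ∈ monoSimplex a b d := by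
      simpa only [monoSimplex, Set.mem_ofPred_eq, hpad] using hf
    refine ⟨_, hmem, WithLp.ofLp_injective 2 ((padEnds_inj (a := a) (b := b)).1 ?_)⟩
    rw [padEnds_repeatEntries, hpad, hx'f]

theorem dist_repeatEntries_sq (r : Fin n → Fin (d + 2)) (y y' : EuclideanSpace ℝ (Fin d)) :
    dist (repeatEntries a b r y) (repeatEntries a b r y') ^ 2 =
      ∑ j : Fin d, Finset.card {t | r t = j.castSucc.succ} * (y j - y' j) ^ 2 := by
  have hfiber (i : Fin (d + 2)) :
      ∑ t with r t = i, (padEnds a b y (r t) - padEnds a b y' (r t)) ^ 2 =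
        Finset.card {t | r t = i} * (padEnds a b y i - padEnds a b y' i) ^ 2 := by
    rw [← nsmul_eq_mul, ← Finset.sum_const]
    exact Finset.sum_congr rfl fun t ht => by rw [(Finset.mem_filter.1 ht).2]
  calc dist (repeatEntries a b r y) (repeatEntries a b r y') ^ 2
      = ∑ t, (padEnds a b y (r t) - padEnds a b y' (r t)) ^ 2 := by
        simp [EuclideanSpace.dist_sq_eq, repeatEntries, Real.dist_eq]
    _ = ∑ i, Finset.card {t | r t = i} * (padEnds a b y i - padEnds a b y' i) ^ 2 := by
        rw [← Finset.sum_fiberwise _ r]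
        exact Finset.sum_congr rfl fun i _ => hfiber i
    _ = ∑ j : Fin d, Finset.card {t | r t = j.castSucc.succ} * (y j - y' j) ^ 2 := by
        rw [Fin.sum_univ_succ, Fin.sum_univ_castSucc]
        simp [Fin.succ_last]

/-- Repeating an entry `m` times stretches its coordinate axis by `√m`, and rescaling the axes of
a simplex of monotone tuples gives an orthoscheme. -/
theorem exists_isometry_image_eq_monoFace (hab : a < b) {x : EuclideanSpace ℝ (Fin n)}
    (hx : x ∈ monoSimplex a b n) :
    ∃ (d : ℕ) (A : Set (EuclideanSpace ℝ (Fin d)))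
      (ψ : EuclideanSpace ℝ (Fin d) → EuclideanSpace ℝ (Fin n)),
      IsOrthoscheme d A ∧ Isometry ψ ∧ ψ '' A = monoFace a b x := by
  obtain ⟨d, g, r, H⟩ := exists_isGrid hab (mem_Icc_of_monotone_padEnds hx)
  let m (j : Fin d) : ℕ := Finset.card {t | r t = j.castSucc.succ}
  have hm (j : Fin d) : 0 < (m j : ℝ) := by
    obtain ⟨t, ht⟩ := coversInterior_iff.1 H.coversInterior j.castSucc.succ (Fin.succ_ne_zero _)
      (by simp [← Fin.succ_last])
    exact_mod_cast Finset.card_pos.2 ⟨t, by simpa using ht⟩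
  have hw (j : Fin d) : √(m j) ≠ 0 := (Real.sqrt_pos.2 (hm j)).ne'
  refine ⟨d, _, repeatEntries a b r ∘ (Matrix.diagonal fun j => (√(m j))⁻¹).toEuclideanLin,
    isOrthoscheme_image_diagonal hab hw, Isometry.of_dist_eq fun c c' => ?_, ?_⟩
  · rw [← sq_eq_sq₀ dist_nonneg dist_nonneg, Function.comp_apply, Function.comp_apply,
      dist_repeatEntries_sq, EuclideanSpace.dist_sq_eq]
    refine Finset.sum_congr rfl fun j _ => ?_
    have := Real.sq_sqrt (hm j).le
    simp only [Matrix.toLpLin_apply, Matrix.mulVec_diagonal, Real.dist_eq, sq_abs, ← mul_sub,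
      mul_pow, inv_pow, this]
    rw [← mul_assoc, mul_inv_cancel₀ (hm j).ne', one_mul]
  · have hinv (y : EuclideanSpace ℝ (Fin d)) : (Matrix.diagonal fun j => (√(m j))⁻¹).toEuclideanLin
        ((Matrix.diagonal fun j => √(m j)).toEuclideanLin y) = y := by
      ext j
      simp [Matrix.toLpLin_apply, Matrix.mulVec_diagonal, hw j]
    simp only [Set.image_image, Function.comp_apply, hinv]
    exact H.repeatEntries_image_monoSimplex hx

end FaceShape

section SortedCell

theorem polyhedron_comp {E E' κ : Type*} [NormedAddCommGroup E] [NormedSpace ℝ E]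
    [NormedAddCommGroup E'] [NormedSpace ℝ E'] (f : κ → E →ᴬ[ℝ] ℝ) (A : E' →ᴬ[ℝ] E) :
    polyhedron (fun k => (f k).comp A) = A ⁻¹' polyhedron f :=
  rfl

theorem tightFace_comp {E E' κ : Type*} [NormedAddCommGroup E] [NormedSpace ℝ E]
    [NormedAddCommGroup E'] [NormedSpace ℝ E'] (f : κ → E →ᴬ[ℝ] ℝ) (A : E' →ᴬ[ℝ] E) (u : E') :
    tightFace (fun k => (f k).comp A) u = A ⁻¹' tightFace f (A u) :=
  rfl

variable {n : ℕ} {xl xr yb yt : ℝ}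

/-- The Euclidean space of `n` points of the plane, as pairs of the tuple of real parts and the
tuple of imaginary parts. -/
abbrev PlaneTuple (n : ℕ) : Type := WithLp 2 (EuclideanSpace ℝ (Fin n) × EuclideanSpace ℝ (Fin n))

/-- The splitting of a vector into its first `n` and its last `n` coordinates. It is needed only
because the polytopes of an `EuclideanComplex` lie in spaces `EuclideanSpace ℝ (Fin d)`. -/
noncomputable def halves (n : ℕ) : EuclideanSpace ℝ (Fin (n + n)) ≃ₗᵢ[ℝ] PlaneTuple n :=
  (LinearIsometryEquiv.piLpCongrLeft 2 ℝ ℝ finSumFinEquiv.symm).trans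
    (PiLp.sumPiLpEquivProdLpPiLp 2 _)

/-- The inequalities that say that the two halves of a vector are sorted tuples in `[xl, xr]` and in
`[yb, yt]`. -/
noncomputable def sortedIneq (xl xr yb yt : ℝ) (n : ℕ) :
    {p : Fin (n + 2) × Fin (n + 2) // p.1 ≤ p.2} ⊕ {p : Fin (n + 2) × Fin (n + 2) // p.1 ≤ p.2} →
      EuclideanSpace ℝ (Fin (n + n)) →ᴬ[ℝ] ℝ :=
  let split : EuclideanSpace ℝ (Fin (n + n)) →L[ℝ] PlaneTuple n := halves n
  Sum.elim
    (fun p => (padDiff xl xr p).comp ((WithLp.fstL 2 ℝ _ _).comp split).toContinuousAffineMap)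
    (fun p => (padDiff yb yt p).comp ((WithLp.sndL 2 ℝ _ _).comp split).toContinuousAffineMap)

/-- The polytope of all pairs of sorted `n`-tuples in `[xl, xr]` and in `[yb, yt]`. -/
abbrev sortedCell (xl xr yb yt : ℝ) (n : ℕ) : Set (EuclideanSpace ℝ (Fin (n + n))) :=
  polyhedron (sortedIneq xl xr yb yt n)

/-- The smallest face of `sortedCell xl xr yb yt n` containing `u`. -/
abbrev sortedFace (xl xr yb yt : ℝ) (u : EuclideanSpace ℝ (Fin (n + n))) :
    Set (EuclideanSpace ℝ (Fin (n + n))) :=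
  tightFace (sortedIneq xl xr yb yt n) u

theorem mem_sortedCell {u : EuclideanSpace ℝ (Fin (n + n))} :
    u ∈ sortedCell xl xr yb yt n ↔
      (halves n u).fst ∈ monoSimplex xl xr n ∧ (halves n u).snd ∈ monoSimplex yb yt n := by
  rw [sortedCell, sortedIneq, polyhedron_sumElim, polyhedron_comp, polyhedron_comp,
    polyhedron_padDiff, polyhedron_padDiff]
  rfl

theorem mem_sortedFace {u v : EuclideanSpace ℝ (Fin (n + n))} :
    v ∈ sortedFace xl xr yb yt u ↔
      (halves n v).fst ∈ monoFace xl xr (halves n u).fst ∧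
        (halves n v).snd ∈ monoFace yb yt (halves n u).snd := by
  rw [sortedFace, sortedIneq, tightFace_sumElim, tightFace_comp, tightFace_comp,
    tightFace_padDiff, tightFace_padDiff]
  rfl

theorem exists_sortedCell_eq_convexHull (hx : xl < xr) (hy : yb < yt) (n : ℕ) :
    ∃ s : Finset (EuclideanSpace ℝ (Fin (n + n))), s.Nonempty ∧
      sortedCell xl xr yb yt n = convexHull ℝ (s : Set (EuclideanSpace ℝ (Fin (n + n)))) := by
  classical
  let join : (EuclideanSpace ℝ (Fin n) × EuclideanSpace ℝ (Fin n)) ≃ₗ[ℝ]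
      EuclideanSpace ℝ (Fin (n + n)) :=
    (WithLp.linearEquiv 2 ℝ _).symm.trans (halves n).symm.toLinearEquiv
  have hjoin : sortedCell xl xr yb yt n = join '' (monoSimplex xl xr n ×ˢ monoSimplex yb yt n) := by
    ext u
    rw [LinearEquiv.image_eq_preimage_symm]
    exact mem_sortedCell
  refine ⟨(Finset.univ.image (stepTuple xl xr) ×ˢ Finset.univ.image (stepTuple yb yt)).image join,
    by simp, ?_⟩
  rw [hjoin, ← convexHull_range_stepTuple hx, ← convexHull_range_stepTuple hy, ← convexHull_prod]
  simp only [Finset.coe_image, Finset.coe_product, Finset.coe_univ, Set.image_univ]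
  exact join.toLinearMap.image_convexHull _

theorem isBiOrthoscheme_sortedFace (hx : xl < xr) (hy : yb < yt)
    {u : EuclideanSpace ℝ (Fin (n + n))} (hu : u ∈ sortedCell xl xr yb yt n) :
    IsBiOrthoscheme (sortedFace xl xr yb yt u) := by
  obtain ⟨d, A, ψ, hA, hψ, hψA⟩ := exists_isometry_image_eq_monoFace hx (mem_sortedCell.1 hu).1
  obtain ⟨e, B, χ, hB, hχ, hχB⟩ := exists_isometry_image_eq_monoFace hy (mem_sortedCell.1 hu).2
  let Ψ := (halves n).symm ∘ WithLp.map 2 (Prod.map ψ χ)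
  have hΨ : Isometry Ψ := (halves n).symm.isometry.comp (hψ.withLpProdMap 2 hχ)
  have hface : Set.range (fun w : {w : WithLp 2 (_ × _) | w.fst ∈ A ∧ w.snd ∈ B} => Ψ w) =
      sortedFace xl xr yb yt u := by
    ext v
    rw [mem_sortedFace, ← hψA, ← hχB]
    constructor
    · rintro ⟨w, rfl⟩
      simp only [Ψ, Function.comp_apply, LinearIsometryEquiv.apply_symm_apply]
      exact ⟨⟨_, w.2.1, rfl⟩, ⟨_, w.2.2, rfl⟩⟩
    · rintro ⟨⟨p, hp, hp'⟩, ⟨q, hq, hq'⟩⟩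
      refine ⟨⟨WithLp.toLp 2 (p, q), hp, hq⟩, (halves n).symm_apply_eq.2 ?_⟩
      exact WithLp.ofLp_injective 2 (Prod.ext hp' hq')
  rw [← hface]
  exact ⟨d, e, A, B, hA, hB, ⟨(hΨ.comp isometry_subtype_coe).isometryEquivOnRange.symm⟩⟩

end SortedCell

namespace Mult

variable {n : ℕ} {X Y : Type*}

theorem mk_surjective : Function.Surjective (mk : (Fin n → X) → Mult n X) :=
  Quotient.mk_surjective

theorem mk_eq_mk_iff {z w : Fin n → X} : mk z = mk w ↔ ∃ σ : Equiv.Perm (Fin n), z = w ∘ σ :=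
  Quotient.eq (r := permSetoid n X)

variable [MetricSpace X] [MetricSpace Y]

theorem tupleDist_isometry_comp {e : X → Y} (he : Isometry e) (z w : Fin n → X) :
    tupleDist (e ∘ z) (e ∘ w) = tupleDist z w := by
  have h2 : 0 < (2 : ℝ≥0∞).toReal := by norm_num
  simp only [tupleDist, PiLp.dist_eq_sum h2, Function.comp_apply, he.dist_eq]

theorem dist_map {e : X → Y} (he : Isometry e) (z w : Mult n X) :
    dist (z.map e) (w.map e) = dist z w := by
  obtain ⟨z, rfl⟩ := mk_surjective z
  obtain ⟨w, rfl⟩ := mk_surjective w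
  exact iInf_congr fun σ => tupleDist_isometry_comp he z (w ∘ σ)

/-- The isometry of multiset spaces induced by an isometry of spaces. -/
def mapIso (e : X ≃ᵢ Y) : Mult n X ≃ᵢ Mult n Y where
  toFun := map e
  invFun := map e.symm
  left_inv := mk_surjective.forall.2 fun z =>
    congrArg mk (funext fun t => e.symm_apply_apply (z t))
  right_inv := mk_surjective.forall.2 fun z =>
    congrArg mk (funext fun t => e.apply_symm_apply (z t))
  isometry_toFun := Isometry.of_dist_eq (dist_map e.isometry)

end Mult

section Composition

theorem exists_strictMono_zero_last {a b : ℝ} (hab : a < b) (h : ℕ) :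
    ∃ g : Fin (h + 2) → ℝ, StrictMono g ∧ g 0 = a ∧ g (Fin.last (h + 1)) = b := by
  refine ⟨fun i => a + (b - a) * (i / (h + 1)), fun i j hij => ?_, by simp, ?_⟩
  · have := sub_pos.2 hab
    have : (i : ℝ) < j := Nat.cast_lt.2 hij
    dsimp only
    gcongr
  · have : (h : ℝ) + 1 ≠ 0 := by positivity
    simp [this]

variable {n h k : ℕ} {xl xr yb yt : ℝ}

/-- The coordinate rectangle `[xl, xr] + i [yb, yt]`. -/
abbrev coordRect (xl xr yb yt : ℝ) : Set ℂ := Set.Icc xl xr ×ℂ Set.Icc yb yt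

/-- The real parts of the points of a tuple. -/
def reTuple (z : Fin n → coordRect xl xr yb yt) : Fin n → ℝ := fun t => (z t : ℂ).re

/-- The imaginary parts of the points of a tuple. -/
def imTuple (z : Fin n → coordRect xl xr yb yt) : Fin n → ℝ := fun t => (z t : ℂ).im

theorem reTuple_mem_Icc (z : Fin n → coordRect xl xr yb yt) (t : Fin n) :
    reTuple z t ∈ Set.Icc xl xr :=
  (z t).2.1

theorem imTuple_mem_Icc (z : Fin n → coordRect xl xr yb yt) (t : Fin n) :
    imTuple z t ∈ Set.Icc yb yt :=
  (z t).2.2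

theorem eq_iff_reTuple_imTuple {z w : Fin n → coordRect xl xr yb yt} :
    z = w ↔ reTuple z = reTuple w ∧ imTuple z = imTuple w := by
  simp only [funext_iff, Subtype.ext_iff, Complex.ext_iff, forall_and, reTuple, imTuple]

theorem count_mk (z : Fin n → coordRect xl xr yb yt) (c : ℂ) :
    ((Mult.mk z).map Subtype.val).count c = Nat.card {t // (z t : ℂ) = c} :=
  rfl

theorem count_mk_of_isGrid {z : Fin n → coordRect xl xr yb yt} {g : Fin (h + 2) → ℝ}
    {r : Fin n → Fin (h + 2)} {g' : Fin (k + 2) → ℝ} {s : Fin n → Fin (k + 2)}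
    (H : IsGrid xl xr (reTuple z) g r) (H' : IsGrid yb yt (imTuple z) g' s) (i : Fin (h + 2))
    (j : Fin (k + 2)) :
    ((Mult.mk z).map Subtype.val).count ⟨g i, g' j⟩ = countMatrix r s i j := by
  obtain ⟨hg, -, -, -, hr⟩ := isGrid_iff.1 H
  obtain ⟨hg', -, -, -, hs⟩ := isGrid_iff.1 H'
  have hre (t : Fin n) : (z t : ℂ).re = g (r t) := congrFun hr t
  have him (t : Fin n) : (z t : ℂ).im = g' (s t) := congrFun hs t
  rw [count_mk, ← nat_card_eq_countMatrix]
  simp only [Complex.ext_iff, hre, him, hg.injective.eq_iff, hg'.injective.eq_iff, Prod.mk.injEq]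

theorem IsMultiplicityMatrix.exists_isGrid {z : Fin n → coordRect xl xr yb yt} {a : RectComp n}
    (ha : IsMultiplicityMatrix xl xr yb yt (Mult.mk z) a) :
    ∃ (g : Fin (a.h + 2) → ℝ) (g' : Fin (a.k + 2) → ℝ) (r : Fin n → Fin (a.h + 2))
      (s : Fin n → Fin (a.k + 2)), IsGrid xl xr (reTuple z) g r ∧ IsGrid yb yt (imTuple z) g' s ∧
        a.mat = countMatrix r s := by
  obtain ⟨h, k, M, hM⟩ := a
  obtain ⟨g, g', hg, h0, h1, hg', h0', h1', hcount⟩ := ha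
  obtain ⟨r, s, rfl⟩ := exists_eq_countMatrix M hM.sum_eq
  obtain ⟨hr, hs⟩ := isRectComposition_countMatrix_iff.1 hM
  have hf : Function.Injective fun c : Fin (h + 2) × Fin (k + 2) => (⟨g c.1, g' c.2⟩ : ℂ) :=
    fun c d hcd => Prod.ext (hg.injective (congrArg Complex.re hcd))
      (hg'.injective (congrArg Complex.im hcd))
  obtain ⟨σ, hσ⟩ := exists_perm_comp_eq_of_card_fiber_eq (c := fun t => (r t, s t))
    (z := fun t => (z t : ℂ)) hf fun c => by
      rw [nat_card_eq_countMatrix, ← count_mk, hcount]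
  have hre : reTuple z ∘ σ = g ∘ r := funext fun t => congrArg Complex.re (congrFun hσ t)
  have him : imTuple z ∘ σ = g' ∘ s := funext fun t => congrArg Complex.im (congrFun hσ t)
  have H := (isGrid_iff.2 ⟨hg, hr, h0, h1, hre⟩).comp_perm σ⁻¹
  have H' := (isGrid_iff.2 ⟨hg', hs, h0', h1', him⟩).comp_perm σ⁻¹
  refine ⟨g, g', r ∘ ⇑σ⁻¹, s ∘ ⇑σ⁻¹, ?_, ?_, (countMatrix_comp_perm r s _).symm⟩
  · simpa [Function.comp_assoc] using H
  · simpa [Function.comp_assoc] using H'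

theorem isMultiplicityMatrix_mk_iff {z : Fin n → coordRect xl xr yb yt} {g : Fin (h + 2) → ℝ}
    {r : Fin n → Fin (h + 2)} {g' : Fin (k + 2) → ℝ} {s : Fin n → Fin (k + 2)}
    (H : IsGrid xl xr (reTuple z) g r) (H' : IsGrid yb yt (imTuple z) g' s) {a : RectComp n} :
    IsMultiplicityMatrix xl xr yb yt (Mult.mk z) a ↔
      a = RectComp.ofIndices r s H.coversInterior H'.coversInterior := by
  constructor
  · intro ha
    obtain ⟨f, f', r', s', K, K', hmat⟩ := ha.exists_isGrid
    obtain ⟨h', k', M, hM⟩ := a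
    dsimp only at f f' r' s' K K' hmat
    subst hmat
    cases K.sigma_eq H
    cases K'.sigma_eq H'
    rfl
  · rintro rfl
    obtain ⟨hg, -, h0, h1, -⟩ := isGrid_iff.1 H
    obtain ⟨hg', -, h0', h1', -⟩ := isGrid_iff.1 H'
    exact ⟨g, g', hg, h0, h1, hg', h0', h1', count_mk_of_isGrid H H'⟩

theorem exists_isMultiplicityMatrix_iff (hx : xl < xr) (hy : yb < yt)
    (z : Mult n (coordRect xl xr yb yt)) :
    ∃ b, ∀ a, IsMultiplicityMatrix xl xr yb yt z a ↔ a = b := by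
  obtain ⟨z, rfl⟩ := Mult.mk_surjective z
  obtain ⟨h, g, r, H⟩ := exists_isGrid hx (reTuple_mem_Icc z)
  obtain ⟨k, g', s, H'⟩ := exists_isGrid hy (imTuple_mem_Icc z)
  exact ⟨_, fun a => isMultiplicityMatrix_mk_iff H H'⟩

/-- The composition of a multiset in a nondegenerate rectangle. -/
noncomputable def composition (hx : xl < xr) (hy : yb < yt) (z : Mult n (coordRect xl xr yb yt)) :
    RectComp n :=
  (exists_isMultiplicityMatrix_iff hx hy z).choose

theorem isMultiplicityMatrix_iff_eq_composition (hx : xl < xr) (hy : yb < yt)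
    {z : Mult n (coordRect xl xr yb yt)} {a : RectComp n} :
    IsMultiplicityMatrix xl xr yb yt z a ↔ a = composition hx hy z :=
  (exists_isMultiplicityMatrix_iff hx hy z).choose_spec a

theorem composition_mk (hx : xl < xr) (hy : yb < yt) {z : Fin n → coordRect xl xr yb yt}
    {g : Fin (h + 2) → ℝ} {r : Fin n → Fin (h + 2)} {g' : Fin (k + 2) → ℝ}
    {s : Fin n → Fin (k + 2)} (H : IsGrid xl xr (reTuple z) g r)
    (H' : IsGrid yb yt (imTuple z) g' s) :
    composition hx hy (Mult.mk z) =
      RectComp.ofIndices r s H.coversInterior H'.coversInterior :=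
  (isMultiplicityMatrix_iff_eq_composition hx hy).1
    ((isMultiplicityMatrix_mk_iff H H').2 rfl) |>.symm

theorem composition_surjective (hx : xl < xr) (hy : yb < yt) :
    Function.Surjective (composition (n := n) hx hy) := by
  intro a
  obtain ⟨r, s, hr, hs, ha⟩ := a.exists_eq_ofIndices
  obtain ⟨g, hg, h0, h1⟩ := exists_strictMono_zero_last hx a.h
  obtain ⟨g', hg', h0', h1'⟩ := exists_strictMono_zero_last hy a.k
  have H : IsGrid xl xr (g ∘ r) g r := isGrid_iff.2 ⟨hg, hr, h0, h1, rfl⟩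
  have H' : IsGrid yb yt (g' ∘ s) g' s := isGrid_iff.2 ⟨hg', hs, h0', h1', rfl⟩
  let z (t : Fin n) : coordRect xl xr yb yt := ⟨⟨g (r t), g' (s t)⟩, H.mem_Icc t, H'.mem_Icc t⟩
  exact ⟨Mult.mk z, (composition_mk hx hy (z := z) H H').trans ha.symm⟩

end Composition

section CellMap

variable {n : ℕ} {xl xr yb yt : ℝ}

/-- The tuple of points whose real parts are the first half of `u` and whose imaginary parts are the
second half of `u` in the order given by `σ`. -/
noncomputable def sortedPoints (σ : Equiv.Perm (Fin n)) (u : sortedCell xl xr yb yt n) :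
    Fin n → coordRect xl xr yb yt := fun t =>
  ⟨⟨(halves n u).fst t, (halves n u).snd (σ t)⟩,
    mem_Icc_of_monotone_padEnds (mem_sortedCell.1 u.2).1 t,
    mem_Icc_of_monotone_padEnds (mem_sortedCell.1 u.2).2 (σ t)⟩

/-- The map of the polytope of sorted tuples to the multiset space that matches the real parts with
the imaginary parts according to `σ`. -/
noncomputable def cellMap (σ : Equiv.Perm (Fin n)) (u : sortedCell xl xr yb yt n) :
    Mult n (coordRect xl xr yb yt) :=
  Mult.mk (sortedPoints σ u)

theorem exists_halves_eq {x y : Fin n → ℝ} (hx : Monotone (padEnds xl xr x))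
    (hy : Monotone (padEnds yb yt y)) :
    ∃ u : sortedCell xl xr yb yt n, ⇑(halves n u).fst = x ∧ ⇑(halves n u).snd = y := by
  let p : PlaneTuple n := WithLp.toLp 2 (WithLp.toLp 2 x, WithLp.toLp 2 y)
  have h : halves n ((halves n).symm p) = p := (halves n).apply_symm_apply p
  refine ⟨⟨(halves n).symm p, mem_sortedCell.2 ?_⟩, ?_⟩ <;> rw [h]
  exacts [⟨hx, hy⟩, ⟨rfl, rfl⟩]

theorem cellMap_eq_cellMap_iff {σ τ : Equiv.Perm (Fin n)} {u v : sortedCell xl xr yb yt n} :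
    cellMap σ u = cellMap τ v ↔ ∃ π : Equiv.Perm (Fin n),
      (halves n u).fst = (halves n v).fst ∘ π ∧
        (halves n u).snd ∘ σ = (halves n v).snd ∘ τ ∘ π := by
  simp only [cellMap, Mult.mk_eq_mk_iff, eq_iff_reTuple_imTuple]
  rfl

theorem eq_of_cellMap_eq {σ τ : Equiv.Perm (Fin n)} {u v : sortedCell xl xr yb yt n}
    (h : cellMap σ u = cellMap τ v) : u = v := by
  obtain ⟨π, hfst, hsnd⟩ := cellMap_eq_cellMap_iff.1 h
  have eq_of_perm {x y : Fin n → ℝ} (hx : Monotone x) (hy : Monotone y) {ρ : Equiv.Perm (Fin n)}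
      (hxy : x = y ∘ ρ) : x = y :=
    hxy.trans (Tuple.unique_monotone (τ := 1) (hxy ▸ hx) hy)
  obtain ⟨hu, hu'⟩ := mem_sortedCell.1 u.2
  obtain ⟨hv, hv'⟩ := mem_sortedCell.1 v.2
  refine Subtype.ext ((halves n).injective (WithLp.ofLp_injective 2 (Prod.ext ?_ ?_)))
  · exact WithLp.ofLp_injective 2 (eq_of_perm (monotone_of_monotone_padEnds hu)
      (monotone_of_monotone_padEnds hv) hfst)
  · refine WithLp.ofLp_injective 2 (eq_of_perm (monotone_of_monotone_padEnds hu')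
      (monotone_of_monotone_padEnds hv') (ρ := τ * π * σ⁻¹) (funext fun t => ?_))
    simpa using congrFun hsnd (σ⁻¹ t)

theorem cellMap_eq_of_mem_sortedFace {σ τ : Equiv.Perm (Fin n)} {u v : sortedCell xl xr yb yt n}
    (h : cellMap σ u = cellMap τ u) (hv : v.1 ∈ sortedFace xl xr yb yt u.1) :
    cellMap σ v = cellMap τ v := by
  obtain ⟨π, hfst, hsnd⟩ := cellMap_eq_cellMap_iff.1 h
  obtain ⟨⟨-, hf⟩, -, hf'⟩ := mem_sortedFace.1 hv
  have transfer {a b : ℝ} {x y : Fin n → ℝ} (hxy : (padEnds a b y).FactorsThrough (padEnds a b x))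
      {i j : Fin n} (hij : x i = x j) : y i = y j := by
    simpa using @hxy i.castSucc.succ j.castSucc.succ (by simpa using hij)
  exact cellMap_eq_cellMap_iff.2 ⟨π, funext fun t => transfer hf (congrFun hfst t),
    funext fun t => transfer hf' (congrFun hsnd t)⟩

theorem exists_sortedPoints_eq_comp (hx : xl ≤ xr) (hy : yb ≤ yt)
    {z : Fin n → coordRect xl xr yb yt} {σ τ : Equiv.Perm (Fin n)}
    (hσ : Monotone (reTuple z ∘ σ)) (hτ : Monotone (imTuple z ∘ τ)) :
    ∃ u, sortedPoints (τ⁻¹ * σ) u = z ∘ σ := by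
  obtain ⟨u, hfst, hsnd⟩ := exists_halves_eq (monotone_padEnds hx hσ fun t => reTuple_mem_Icc z _)
    (monotone_padEnds hy hτ fun t => imTuple_mem_Icc z _)
  have hτσ : τ ∘ ⇑(τ⁻¹ * σ) = σ := funext fun t => by simp
  refine ⟨u, eq_iff_reTuple_imTuple.2 ⟨hfst, ?_⟩⟩
  change (halves n u).snd ∘ ⇑(τ⁻¹ * σ) = imTuple z ∘ σ
  rw [hsnd, Function.comp_assoc, hτσ]

theorem exists_cellMap_eq (hx : xl ≤ xr) (hy : yb ≤ yt) (z : Mult n (coordRect xl xr yb yt)) :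
    ∃ σ u, cellMap (xl := xl) (xr := xr) (yb := yb) (yt := yt) σ u = z := by
  obtain ⟨z, rfl⟩ := Mult.mk_surjective z
  obtain ⟨u, hu⟩ := exists_sortedPoints_eq_comp hx hy (Tuple.monotone_sort (reTuple z))
    (Tuple.monotone_sort (imTuple z))
  exact ⟨_, u, Mult.mk_eq_mk_iff.2 ⟨_, hu⟩⟩

theorem tupleDist_eq_sqrt (z w : Fin n → coordRect xl xr yb yt) :
    Mult.tupleDist z w =
      √(∑ t, (dist (reTuple z t) (reTuple w t) ^ 2 + dist (imTuple z t) (imTuple w t) ^ 2)) := by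
  rw [← Mult.tupleDist_isometry_comp isometry_subtype_coe, Mult.tupleDist, PiLp.dist_eq_of_L2]
  congr! 2 with t
  simp only [Function.comp_apply, Complex.dist_eq_re_im, reTuple, imTuple, Real.dist_eq, sq_abs]
  exact Real.sq_sqrt (by positivity)

theorem tupleDist_sortedPoints (σ : Equiv.Perm (Fin n)) (u v : sortedCell xl xr yb yt n) :
    Mult.tupleDist (sortedPoints σ u) (sortedPoints σ v) = dist u v := by
  rw [tupleDist_eq_sqrt, Subtype.dist_eq, ← (halves n).dist_map, WithLp.prod_dist_eq_of_L2,
    EuclideanSpace.dist_sq_eq, EuclideanSpace.dist_sq_eq, Finset.sum_add_distrib]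
  congr 2
  exact Equiv.sum_comp σ fun t => dist ((halves n u).snd t) ((halves n v).snd t) ^ 2

theorem dist_cellMap_le (σ : Equiv.Perm (Fin n)) (u v : sortedCell xl xr yb yt n) :
    dist (cellMap σ u) (cellMap σ v) ≤ dist u v :=
  (Mult.orbitDist_le _ _ 1).trans_eq (tupleDist_sortedPoints σ u v)

theorem exists_composition_cellMap_eq (hx : xl < xr) (hy : yb < yt)
    (u : sortedCell xl xr yb yt n) :
    ∃ (h k : ℕ) (g : Fin (h + 2) → ℝ) (g' : Fin (k + 2) → ℝ) (r : Fin n → Fin (h + 2))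
      (s : Fin n → Fin (k + 2)) (H : IsGrid xl xr (halves n u).fst g r)
      (H' : IsGrid yb yt (halves n u).snd g' s), ∀ σ : Equiv.Perm (Fin n),
        composition hx hy (cellMap σ u) =
          RectComp.ofIndices r (s ∘ σ) H.coversInterior (H'.comp_perm σ).coversInterior := by
  obtain ⟨hu, hu'⟩ := mem_sortedCell.1 u.2
  obtain ⟨h, g, r, H⟩ := exists_isGrid hx (mem_Icc_of_monotone_padEnds hu)
  obtain ⟨k, g', s, H'⟩ := exists_isGrid hy (mem_Icc_of_monotone_padEnds hu')
  exact ⟨h, k, g, g', r, s, H, H', fun σ =>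
    composition_mk hx hy (z := sortedPoints σ u) H (H'.comp_perm σ)⟩

theorem composition_cellMap_le (hx : xl < xr) (hy : yb < yt) (σ : Equiv.Perm (Fin n))
    {u v : sortedCell xl xr yb yt n} (hv : v.1 ∈ sortedFace xl xr yb yt u.1) :
    composition hx hy (cellMap σ v) ≤ composition hx hy (cellMap σ u) := by
  obtain ⟨hu, hu'⟩ := mem_sortedCell.1 u.2
  obtain ⟨⟨hv, hface⟩, hv', hface'⟩ := mem_sortedFace.1 hv
  obtain ⟨h, k, g, g', r, s, H, H', hcomp⟩ := exists_composition_cellMap_eq hx hy u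
  obtain ⟨_, _, _, _, _, _, K, K', hcomp'⟩ := exists_composition_cellMap_eq hx hy v
  obtain ⟨ρ, hρ, rfl⟩ := H.exists_eq_comp K hu hv hface
  obtain ⟨γ, hγ, rfl⟩ := H'.exists_eq_comp K' hu' hv' hface'
  rw [hcomp, hcomp', RectComp.le_ofIndices_iff]
  exact ⟨ρ, γ, hρ, hγ, rfl⟩

theorem exists_mem_sortedFace_of_composition_le (hx : xl < xr) (hy : yb < yt)
    {σ : Equiv.Perm (Fin n)} {u : sortedCell xl xr yb yt n} {w : Mult n (coordRect xl xr yb yt)}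
    (hw : composition hx hy w ≤ composition hx hy (cellMap σ u)) :
    ∃ v : sortedCell xl xr yb yt n, v.1 ∈ sortedFace xl xr yb yt u.1 ∧ cellMap σ v = w := by
  obtain ⟨z, rfl⟩ := Mult.mk_surjective w
  obtain ⟨hu, hu'⟩ := mem_sortedCell.1 u.2
  obtain ⟨h, k, g, g', r, s, H, H', hcomp⟩ := exists_composition_cellMap_eq hx hy u
  obtain ⟨_, f, p, K⟩ := exists_isGrid hx (reTuple_mem_Icc z)
  obtain ⟨_, f', q, K'⟩ := exists_isGrid hy (imTuple_mem_Icc z)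
  rw [hcomp, composition_mk hx hy K K', RectComp.le_ofIndices_iff] at hw
  obtain ⟨ρ, γ, ⟨hρ, hρs⟩, ⟨hγ, hγs⟩, hmat⟩ := hw
  obtain ⟨hf, -, h0, h1, hfp⟩ := isGrid_iff.1 K
  obtain ⟨hf', -, h0', h1', hfq⟩ := isGrid_iff.1 K'
  obtain ⟨-, hmono, hface⟩ := H.collapse hu hρ hρs hf h0 h1
  obtain ⟨-, hmono', hface'⟩ := H'.collapse hu' hγ hγs hf' h0' h1'
  obtain ⟨v, hv, hv'⟩ := exists_halves_eq hmono hmono'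
  obtain ⟨π, hp, hq⟩ := exists_perm_of_countMatrix_eq hmat.symm
  refine ⟨v, mem_sortedFace.2 ⟨⟨?_, ?_⟩, ?_, ?_⟩,
    Mult.mk_eq_mk_iff.2 ⟨π, eq_iff_reTuple_imTuple.2 ⟨?_, ?_⟩⟩⟩
  · change Monotone (padEnds xl xr (halves n v).fst)
    rwa [hv]
  · rwa [hv]
  · change Monotone (padEnds yb yt (halves n v).snd)
    rwa [hv']
  · rwa [hv']
  · exact hv.trans ((congrArg (f ∘ ·) hp).trans (congrArg (· ∘ π) hfp.symm))
  · exact (congrArg (· ∘ σ) hv').trans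
      ((congrArg (f' ∘ ·) hq).trans (congrArg (· ∘ π) hfq.symm))

end CellMap

theorem EuclideanComplex.edist_pt_le {K : EuclideanComplex} (i : K.ι) (u v : K.cell i) :
    edist (K.pt i u) (K.pt i v) ≤ edist u v :=
  (iInf₂_le _ (.step i u v (.refl _))).trans_eq (add_zero _)

section Complex

variable {n : ℕ} {xl xr yb yt : ℝ}

theorem exists_monotone_comp_of_mul_sub_nonneg {x y : Fin n → ℝ}
    (h : ∀ i j, 0 ≤ (x i - x j) * (y i - y j)) :
    ∃ π : Equiv.Perm (Fin n), Monotone (x ∘ π) ∧ Monotone (y ∘ π) := by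
  refine ⟨Tuple.sort (x + y), fun i j hij => ?_, fun i j hij => ?_⟩
  all_goals
    have hsum := Tuple.monotone_sort (x + y) hij
    have hmul := h (Tuple.sort (x + y) i) (Tuple.sort (x + y) j)
    simp only [Function.comp_apply, Pi.add_apply] at hsum ⊢
    by_contra! hlt
    nlinarith

theorem exists_isometryEquiv_cellMap_eq {σ τ : Equiv.Perm (Fin n)}
    {F G : Set (EuclideanSpace ℝ (Fin (n + n)))} (hF : IsExposed ℝ (sortedCell xl xr yb yt n) F)
    (hG : IsExposed ℝ (sortedCell xl xr yb yt n) G) {u v : sortedCell xl xr yb yt n}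
    (hu : u.1 ∈ intrinsicInterior ℝ F) (hv : v.1 ∈ intrinsicInterior ℝ G)
    (h : cellMap σ u = cellMap τ v) :
    ∃ g : F ≃ᵢ G, ∀ y : F,
      cellMap σ ⟨y, hF.subset y.2⟩ = cellMap τ ⟨g y, hG.subset (g y).2⟩ := by
  obtain rfl := eq_of_cellMap_eq h
  have hFu := eq_tightFace_of_mem_intrinsicInterior hF hu
  obtain rfl : F = G := hFu.trans (eq_tightFace_of_mem_intrinsicInterior hG hv).symm
  exact ⟨IsometryEquiv.refl F, fun y => cellMap_eq_of_mem_sortedFace h (hFu ▸ y.2)⟩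

/-- The complex of multisets in a rectangle. It has one polytope of pairs of sorted tuples for each
permutation, which matches the real parts with the imaginary parts. -/
noncomputable def multComplex (n : ℕ) (hx : xl < xr) (hy : yb < yt) : EuclideanComplex where
  ι := Equiv.Perm (Fin n)
  dim _ := n + n
  cell _ := sortedCell xl xr yb yt n
  polytope _ := exists_sortedCell_eq_convexHull hx hy n
  rel := Setoid.ker fun p => cellMap p.1 p.2
  inj _ _ _ _ _ _ _ h := eq_of_cellMap_eq h
  glue _ _ _ _ hF hG _ _ hu hv h := exists_isometryEquiv_cellMap_eq hF hG hu hv h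

variable (hx : xl < xr) (hy : yb < yt)

/-- The bijection from the complex to the multiset space that is `cellMap σ` on the polytope with
index `σ`. -/
noncomputable def multComplexEquiv :
    (multComplex n hx hy).Space ≃ Mult n (coordRect xl xr yb yt) :=
  Equiv.ofBijective
    (Quotient.lift (s := (multComplex n hx hy).rel) (fun p => cellMap p.1 p.2) fun _ _ h => h) <| by
    refine ⟨?_, fun z => ?_⟩
    · rintro ⟨p⟩ ⟨q⟩ h
      exact Quotient.sound (s := (multComplex n hx hy).rel) h
    · obtain ⟨σ, u, hu⟩ := exists_cellMap_eq hx.le hy.le z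
      exact ⟨(multComplex n hx hy).pt σ u, hu⟩

theorem multComplexEquiv_symm_cellMap (σ : Equiv.Perm (Fin n)) (u : sortedCell xl xr yb yt n) :
    (multComplexEquiv hx hy).symm (cellMap σ u) = (multComplex n hx hy).pt σ u :=
  (multComplexEquiv hx hy).symm_apply_apply ((multComplex n hx hy).pt σ u)

theorem edist_multComplexEquiv_le (p q : (multComplex n hx hy).Space) :
    edist (multComplexEquiv hx hy p) (multComplexEquiv hx hy q) ≤ edist p q := by
  refine le_iInf₂ fun L hL => ?_
  induction hL with
  | refl p => exact (edist_self _).le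
  | step σ u v _ ih =>
    have huv : edist (cellMap σ u) (cellMap σ v) ≤ edist u v := by
      rw [edist_dist, edist_dist]
      exact ENNReal.ofReal_le_ofReal (dist_cellMap_le σ u v)
    exact (edist_triangle _ (cellMap σ v) _).trans (add_le_add huv ih)

theorem edist_multComplexEquiv_symm_mk_le_of_mul_sub_nonneg {z w : Fin n → coordRect xl xr yb yt}
    (hre : ∀ i j, 0 ≤ (reTuple z i - reTuple z j) * (reTuple w i - reTuple w j))
    (him : ∀ i j, 0 ≤ (imTuple z i - imTuple z j) * (imTuple w i - imTuple w j)) :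
    edist ((multComplexEquiv hx hy).symm (Mult.mk z)) ((multComplexEquiv hx hy).symm (Mult.mk w)) ≤
      ENNReal.ofReal (Mult.tupleDist z w) := by
  obtain ⟨σ, hz, hw⟩ := exists_monotone_comp_of_mul_sub_nonneg hre
  obtain ⟨τ, hz', hw'⟩ := exists_monotone_comp_of_mul_sub_nonneg him
  obtain ⟨u, hu⟩ := exists_sortedPoints_eq_comp hx.le hy.le hz hz'
  obtain ⟨v, hv⟩ := exists_sortedPoints_eq_comp hx.le hy.le hw hw'
  rw [← Mult.tupleDist_comp z w σ, ← hu, ← hv, tupleDist_sortedPoints,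
    ← Mult.mk_eq_mk_iff.2 ⟨σ, hu⟩, ← Mult.mk_eq_mk_iff.2 ⟨σ, hv⟩, ← edist_dist]
  change edist ((multComplexEquiv hx hy).symm (cellMap _ u))
    ((multComplexEquiv hx hy).symm (cellMap _ v)) ≤ _
  rw [multComplexEquiv_symm_cellMap, multComplexEquiv_symm_cellMap]
  exact EuclideanComplex.edist_pt_le (K := multComplex n hx hy) _ u v

/-- The functionals `z ↦ re (z i) - re (z j)` and `z ↦ im (z i) - im (z j)`, whose signs tell how
the real parts and the imaginary parts of `z` are ordered. -/
noncomputable def coordDiff (n : ℕ) :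
    (Fin n × Fin n) ⊕ (Fin n × Fin n) → PiLp 2 (fun _ : Fin n => ℂ) →ᵃ[ℝ] ℝ :=
  let diff (ij : Fin n × Fin n) : PiLp 2 (fun _ : Fin n => ℂ) →ₗ[ℝ] ℂ :=
    PiLp.projₗ (𝕜 := ℝ) 2 (fun _ => ℂ) ij.1 - PiLp.projₗ (𝕜 := ℝ) 2 (fun _ => ℂ) ij.2
  Sum.elim (fun ij => (Complex.reLm ∘ₗ diff ij).toAffineMap)
    (fun ij => (Complex.imLm ∘ₗ diff ij).toAffineMap)

theorem convex_coordRect : Convex ℝ (coordRect xl xr yb yt) :=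
  ((convex_Icc xl xr).linear_preimage Complex.reLm).inter
    ((convex_Icc yb yt).linear_preimage Complex.imLm)

theorem edist_multComplexEquiv_symm_mk_le (z w : Fin n → coordRect xl xr yb yt) :
    edist ((multComplexEquiv hx hy).symm (Mult.mk z)) ((multComplexEquiv hx hy).symm (Mult.mk w)) ≤
      ENNReal.ofReal (Mult.tupleDist z w) := by
  let C : Set (PiLp 2 fun _ : Fin n => ℂ) := {P | ∀ t, P t ∈ coordRect xl xr yb yt}
  have hC : Convex ℝ C := fun P hP Q hQ a b ha hb hab t =>
    convex_coordRect (hP t) (hQ t) ha hb hab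
  let tuple (P : C) : Fin n → coordRect xl xr yb yt := fun t => ⟨P.1 t, P.2 t⟩
  have edist_eq (P Q : C) : ENNReal.ofReal (Mult.tupleDist (tuple P) (tuple Q)) = edist P Q := by
    rw [← Mult.tupleDist_isometry_comp isometry_subtype_coe]
    exact (edist_dist P Q).symm
  have hlip : LipschitzWith 1 fun P : C => (multComplexEquiv hx hy).symm (Mult.mk (tuple P)) := by
    refine lipschitzWith_one_of_edist_le_of_separating_eq_empty (coordDiff n) hC fun P Q hPQ => ?_
    have hsign (k) : 0 ≤ coordDiff n k P * coordDiff n k Q := by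
      by_contra! hlt
      exact (hPQ ▸ mem_separating.2 hlt : k ∈ (∅ : Set _)).elim
    rw [← edist_eq]
    exact edist_multComplexEquiv_symm_mk_le_of_mul_sub_nonneg hx hy
      (fun i j => hsign (.inl (i, j))) fun i j => hsign (.inr (i, j))
  let ofTuple (z : Fin n → coordRect xl xr yb yt) : C :=
    ⟨WithLp.toLp 2 fun t => z t, fun t => (z t).2⟩
  have h := hlip (ofTuple z) (ofTuple w)
  rwa [ENNReal.coe_one, one_mul, ← edist_eq] at h

theorem isometry_multComplexEquiv : Isometry (multComplexEquiv (n := n) hx hy) := by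
  refine fun p q => (edist_multComplexEquiv_le hx hy p q).antisymm ?_
  obtain ⟨z, hz⟩ := Mult.mk_surjective (multComplexEquiv hx hy p)
  obtain ⟨w, hw⟩ := Mult.mk_surjective (multComplexEquiv hx hy q)
  obtain ⟨σ, hσ⟩ := Mult.exists_orbitDist_eq z w
  have hw' : Mult.mk (w ∘ σ) = multComplexEquiv hx hy q :=
    (Mult.mk_eq_mk_iff.2 ⟨σ, rfl⟩).trans hw
  calc edist p q ≤ ENNReal.ofReal (Mult.tupleDist z (w ∘ σ)) := by
        simpa only [hz, hw', Equiv.symm_apply_apply] using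
          edist_multComplexEquiv_symm_mk_le hx hy z (w ∘ σ)
    _ = edist (multComplexEquiv hx hy p) (multComplexEquiv hx hy q) := by
        rw [hσ, ← hz, ← hw, edist_dist]
        rfl

/-- The isometry from the complex onto the multiset space. -/
noncomputable def multComplexIso : (multComplex n hx hy).Space ≃ᵢ Mult n (coordRect xl xr yb yt) :=
  ⟨multComplexEquiv hx hy, isometry_multComplexEquiv hx hy⟩

end Complex

section FacePoset

variable {n : ℕ} {xl xr yb yt : ℝ} (hx : xl < xr) (hy : yb < yt)

/-- The composition of the multiset that corresponds to a point of the complex. -/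
noncomputable def pointComposition (p : (multComplex n hx hy).Space) : RectComp n :=
  composition hx hy (multComplexIso hx hy p)

theorem pointComposition_surjective :
    Function.Surjective (pointComposition (n := n) hx hy) :=
  (composition_surjective hx hy).comp (multComplexIso hx hy).surjective

theorem image_sortedFace (σ : Equiv.Perm (Fin n)) (u : sortedCell xl xr yb yt n) :
    (multComplex n hx hy).image σ (sortedFace xl xr yb yt u.1) =
      pointComposition hx hy ⁻¹' Set.Iic (composition hx hy (cellMap σ u)) := by
  ext p
  constructor
  · rintro ⟨v, hv, rfl⟩
    exact composition_cellMap_le hx hy σ hv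
  · intro hp
    obtain ⟨v, hv, hvp⟩ := exists_mem_sortedFace_of_composition_le hx hy hp
    exact ⟨v, hv, (multComplexIso hx hy).injective hvp⟩

theorem image_intrinsicInterior_sortedFace (σ : Equiv.Perm (Fin n))
    (u : sortedCell xl xr yb yt n) :
    (multComplex n hx hy).image σ (intrinsicInterior ℝ (sortedFace xl xr yb yt u.1)) =
      {p | pointComposition hx hy p = composition hx hy (cellMap σ u)} := by
  ext p
  constructor
  · rintro ⟨v, hv, rfl⟩
    obtain ⟨hvu, huv⟩ := (mem_intrinsicInterior_tightFace_iff u.2).1 hv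
    exact (composition_cellMap_le hx hy σ hvu).antisymm (composition_cellMap_le hx hy σ huv)
  · intro hp
    obtain ⟨v, hvu, hvp⟩ := exists_mem_sortedFace_of_composition_le hx hy (le_of_eq hp)
    have hle : composition hx hy (cellMap σ u) ≤ composition hx hy (cellMap σ v) :=
      hvp ▸ ge_of_eq hp
    obtain ⟨u', huv, hu'⟩ := exists_mem_sortedFace_of_composition_le hx hy hle
    obtain rfl := eq_of_cellMap_eq hu'
    exact ⟨v, (mem_intrinsicInterior_tightFace_iff u'.2).2 ⟨hvu, huv⟩,
      (multComplexIso hx hy).injective hvp⟩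

theorem isFace_multComplex_iff {σ : Equiv.Perm (Fin n)}
    {F : Set (EuclideanSpace ℝ (Fin (n + n)))} :
    (multComplex n hx hy).IsFace σ F ↔
      ∃ u : sortedCell xl xr yb yt n, F = sortedFace xl xr yb yt u.1 :=
  (isExposed_and_nonempty_iff_exists_eq_tightFace (f := sortedIneq xl xr yb yt n)).trans
    ⟨fun ⟨u, hu, hFu⟩ => ⟨⟨u, hu⟩, hFu⟩, fun ⟨u, hFu⟩ => ⟨u, u.2, hFu⟩⟩

theorem isCell_multComplex_iff {S : Set (multComplex n hx hy).Space} :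
    (multComplex n hx hy).IsCell S ↔ ∃ b, pointComposition hx hy ⁻¹' Set.Iic b = S := by
  constructor
  · rintro ⟨σ, F, hF, rfl⟩
    obtain ⟨u, rfl⟩ := (isFace_multComplex_iff hx hy).1 hF
    exact ⟨_, (image_sortedFace hx hy σ u).symm⟩
  · rintro ⟨b, rfl⟩
    obtain ⟨z, rfl⟩ := composition_surjective hx hy b
    obtain ⟨σ, u, rfl⟩ := exists_cellMap_eq hx.le hy.le z
    exact ⟨σ, _, (isFace_multComplex_iff hx hy).2 ⟨u, rfl⟩, (image_sortedFace hx hy σ u).symm⟩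

/-- The isomorphism from the poset of compositions onto the face poset of the complex that sends a
composition `b` to the cell of all points whose composition is at most `b`. -/
noncomputable def rectCompIso : RectComp n ≃o (multComplex n hx hy).FacePoset :=
  RelIso.ofSurjective
    (OrderEmbedding.ofMapLEIff
      (fun b =>
        ⟨pointComposition hx hy ⁻¹' Set.Iic b, (isCell_multComplex_iff hx hy).2 ⟨b, rfl⟩⟩)
      fun _ _ =>
        (pointComposition_surjective hx hy).preimage_subset_preimage_iff.trans Set.Iic_subset_Iic)
    fun S => ((isCell_multComplex_iff hx hy).1 S.2).imp fun _ => Subtype.ext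

end FacePoset

theorem theoremA {Q : Type*} [MetricSpace Q] (xl xr yb yt : ℝ) (hx : xl < xr) (hy : yb < yt)
    (e : Q ≃ᵢ (Set.Icc xl xr ×ℂ Set.Icc yb yt : Set ℂ)) (n : ℕ) (hn : 1 ≤ n) :
    ∃ (K : EuclideanComplex) (f : K.Space ≃ᵢ Mult n Q) (φ : K.FacePoset ≃o RectComp n),
      ∀ (i : K.ι) (F : Set (EuclideanSpace ℝ (Fin (K.dim i)))) (hF : K.IsFace i F),
        IsBiOrthoscheme F ∧
        f '' K.image i (intrinsicInterior ℝ F) =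
          {z | IsMultiplicityMatrix xl xr yb yt (z.map e) (φ hF.toCell)} := by
  refine ⟨multComplex n hx hy, (multComplexIso hx hy).trans (Mult.mapIso e).symm,
    (rectCompIso hx hy).symm, fun σ F hF => ?_⟩
  obtain ⟨u, rfl⟩ := (isFace_multComplex_iff hx hy).1 hF
  have hφ : (rectCompIso hx hy).symm hF.toCell = composition hx hy (cellMap σ u) :=
    (OrderIso.symm_apply_eq _).2 (Subtype.ext (image_sortedFace hx hy σ u))
  refine ⟨isBiOrthoscheme_sortedFace hx hy u.2, ?_⟩
  let f := (multComplexIso hx hy).trans (Mult.mapIso (n := n) e).symm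
  have hf (z : Mult n Q) : multComplexIso hx hy (f.symm z) = z.map e :=
    (multComplexIso hx hy).apply_symm_apply _
  refine (congrArg (f '' ·) (image_intrinsicInterior_sortedFace hx hy σ u)).trans ?_
  rw [← f.preimage_symm, hφ]
  ext z
  rw [Set.mem_preimage, Set.mem_ofPred_eq, Set.mem_ofPred_eq, pointComposition, hf,
    isMultiplicityMatrix_iff_eq_composition hx hy, eq_comm]
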